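/- **Setting.** Let $a<b$ and let $p,q,w:[a,b]\to\mathbb R$ satisfy $p,p',w,w',q,(pw)',(pw)''\in C([a,b])$ and $p,w>0$. Let $$\mathcal L[u]=\frac1w\left[-(pu')'+qu\right]\quad\text{on }(a,b)$$ be equipped with regular self-adjoint two-point boundary conditions $$M\,(u(a),(pu')(a))^{T}+N\,(u(b),(pu')(b))^{T}=0,$$ where $M,N\in\mathbb C^{2\times2}$, $\operatorname{rank}(M\,|\,N)=2$, $MEM^*=NEN^*$ and $E=\begin{pmatrix}0&-1\\1&0\end{pmatrix}$ (so separated and coupled conditions are both allowed). For an operator, or for a square matrix all of whose eigenvalues are real, let $0\le\lambda_1\le\lambda_2\le\cdots$ denote its non-negative eigenvalues, counted with multiplicity. Put $B=\int_a^b\sqrt{w/p}\,dx$ and $m=(pw)^{1/4}$. Let $\mathcal L_V[v]=-v''+Vv$ on $(0,B)$ be the Liouville normal form of $\mathcal L$, obtained by $y(x)=\int_a^x\sqrt{w/p}\,dt$ and $u(x)=v(y(x))/m(x)$; thus $V=\frac qw+\frac1m\frac{d^2m}{dy^2}$, with the boundary conditions transformed accordingly. For real measurable $\omega$ on $D=[a,b]\times[-\pi,\pi]$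 let $\phi_\omega(t)=|\{\omega\le t\}|/|D|$, let $R_\omega$ be the essential range of $\omega$, and let $\omega^*(x)=\inf\{t\in R_\omega:\phi_\omega(t)>x\}$ for $0<x<1$ be its monotone rearrangement. For matrices $X_n$ of order $d_n\to\infty$ with real eigenvalues, $\{X_n\}_n\sim_\lambda\omega$ means that $\frac1{d_n}\sum_{\lambda}F(\lambda)\to\frac1{|D|}\int_D F(\omega)$ for every $F\in C_c(\mathbb R)$, where the sum runs over all eigenvalues of $X_n$ with algebraic multiplicity. **Statement.** There are constants $c_k\ge0$ ($k\ge1$), depending only on the Sturm–Liouville problem, such that $c_k\to0$ as $k\to\infty$ and, for every $k\geq 1$ with $\lambda_k(\mathcal L)\ne0$, $$c_k=\left|\frac{k^2\pi^2/B^2}{\lambda_k(\mathcal L_V)}-1\right|,$$ and such that the following holds. For every $\eta\in\mathbb N$ let $\mathcal L^{(n,\eta)}$, $n\in\mathbb N$, be square matrices with real eigenvalues, of order $d_n=d_n(\eta)\to\infty$ as $n\to\infty$, and let $\omega_\eta\in L^1([a,b]\times[-\pi,\pi])$ be real-valued. Assume that for every $\eta$: (a) $\lim_{n\to\infty}\lambda_k(\mathcal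 L^{(n,\eta)})=\lambda_k(\mathcal L)$ for each fixed $k\ge1$; (b) $\{(d_n+1)^{-2}\mathcal L^{(n,\eta)}\}_n\sim_\lambda\omega_\eta$; (c) $\omega_\eta^*(x)\sim x^2\pi^2/B^2$ as $x\to0^+$. Then for every $\eta$ and every fixed $k\ge1$ with $\lambda_k(\mathcal L)\neq0$, $$\lim_{n\to\infty}\left|\frac{(d_n+1)^2\omega_\eta^*\left(\frac k{d_n+1}\right)}{\lambda_k(\mathcal L^{(n,\eta)})}-1\right|=\lim_{n\to\infty}\left|\frac{(d_n+1)^2\omega_\eta^*\left(\frac k{d_n+1}\right)}{\lambda_k(\mathcal L_V)}-1\right|=c_k ,$$ so that $c_k$ is independent of $\eta$. In particular, the analytic spectral error converges to $c_k$: for every sequence $n'=n'(n)\to\infty$ of finer meshes and all approximations $s_n$ of the samples of the rearrangement with $(d_n+1)^2\left(s_n-\omega^*_\eta\left(\frac k{d_n+1}\right)\right)\to0$ (for instance the exact samples), $$\lim_{n\to\infty}\left|\frac{(d_n+1)^2s_n}{\lambda_k(\mathcal L^{(n',\eta)})}-1\right|=c_k .$$ -/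

import Mathlib

open Filter Topology MeasureTheory Asymptotics

noncomputable section

/-- Given a counting function `N` (where `N t` is the number of eigenvalues in `[0, t]`, counted
with multiplicity), the `k`-th non-negative eigenvalue `0 ≤ λ₁ ≤ λ₂ ≤ ⋯` (for `k ≥ 1`). -/
def kthNonneg (N : ℝ → ℕ) (k : ℕ) : ℝ :=
  sInf {t : ℝ | 0 ≤ t ∧ k ≤ N t}

/-! ### Sturm–Liouville problems -/

/-- The data of a Sturm–Liouville operator `u ↦ (1/w) (-(p u')' + q u)` on `[a, b]` with the
two-point boundary conditions `bcL (u(a), (p u')(a))ᵀ + bcR (u(b), (p u')(b))ᵀ = 0`. -/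
structure SturmLiouville where
  a : ℝ
  b : ℝ
  p : ℝ → ℝ
  q : ℝ → ℝ
  w : ℝ → ℝ
  bcL : Matrix (Fin 2) (Fin 2) ℂ
  bcR : Matrix (Fin 2) (Fin 2) ℂ

namespace SturmLiouville

/-- The underlying interval `[a, b]`. -/
def dom (P : SturmLiouville) : Set ℝ := Set.Icc P.a P.b

/-- Regularity of the coefficients, positivity of `p` and `w`, and regular self-adjoint boundary
conditions (separated or coupled): two independent conditions, which are self-adjoint. -/
structure IsRegular (P : SturmLiouville) : Prop where
  lt : P.a < P.b
  contDiffOn_p : ContDiffOn ℝ 1 P.p P.dom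
  contDiffOn_w : ContDiffOn ℝ 1 P.w P.dom
  continuousOn_q : ContinuousOn P.q P.dom
  contDiffOn_pw : ContDiffOn ℝ 2 (fun x => P.p x * P.w x) P.dom
  p_pos : ∀ x ∈ P.dom, 0 < P.p x
  w_pos : ∀ x ∈ P.dom, 0 < P.w x
  bc_rank : (Matrix.fromCols P.bcL P.bcR).rank = 2
  bc_selfAdjoint : P.bcL * !![0, -1; 1, 0] * P.bcL.conjTranspose =
    P.bcR * !![0, -1; 1, 0] * P.bcR.conjTranspose

/-- The quasi-derivative `p u'`. -/
def quasiDeriv (P : SturmLiouville) (u : ℝ → ℂ) (x : ℝ) : ℂ :=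
  (P.p x : ℂ) * derivWithin u P.dom x

/-- The formal expression `(1/w) (-(p u')' + q u)`. -/
def expr (P : SturmLiouville) (u : ℝ → ℂ) (x : ℝ) : ℂ :=
  (1 / (P.w x : ℂ)) * (-derivWithin (P.quasiDeriv u) P.dom x + (P.q x : ℂ) * u x)

/-- The boundary conditions. -/
def SatisfiesBC (P : SturmLiouville) (u : ℝ → ℂ) : Prop :=
  P.bcL.mulVec ![u P.a, P.quasiDeriv u P.a] + P.bcR.mulVec ![u P.b, P.quasiDeriv u P.b] = 0

/-- `u` is a solution of `ℒ u = lam u` on `[a, b]` satisfying the boundary conditions. Functions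
on `[a, b]` are represented by functions on `ℝ` that vanish outside `[a, b]`. -/
structure IsSolution (P : SturmLiouville) (lam : ℝ) (u : ℝ → ℂ) : Prop where
  zero_outside : ∀ x, x ∉ P.dom → u x = 0
  diff : DifferentiableOn ℝ u P.dom
  diff_quasi : DifferentiableOn ℝ (P.quasiDeriv u) P.dom
  bc : P.SatisfiesBC u
  eqn : ∀ x ∈ P.dom, P.expr u x = (lam : ℂ) * u x

theorem quasiDeriv_add (P : SturmLiouville) {u v : ℝ → ℂ}
    (hu : DifferentiableOn ℝ u P.dom) (hv : DifferentiableOn ℝ v P.dom) :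
    P.quasiDeriv (u + v) = P.quasiDeriv u + P.quasiDeriv v := by
  funext x
  by_cases hx : x ∈ P.dom
  · simp only [quasiDeriv, Pi.add_apply, derivWithin_add (hu x hx) (hv x hx), mul_add]
  · have hx' : x ∉ closure P.dom := by rwa [dom, isClosed_Icc.closure_eq]
    simp only [quasiDeriv, Pi.add_apply, derivWithin_zero_of_notMem_closure hx', mul_zero,
      add_zero]

theorem quasiDeriv_smul (P : SturmLiouville) (c : ℂ) (u : ℝ → ℂ) :
    P.quasiDeriv (c • u) = c • P.quasiDeriv u := by
  funext x
  simp only [quasiDeriv, derivWithin_const_smul_field, smul_eq_mul, Pi.smul_apply]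
  ring

/-- The eigenspace of the Sturm–Liouville operator at the real number `lam`. -/
def eigenspace (P : SturmLiouville) (lam : ℝ) : Submodule ℂ (ℝ → ℂ) where
  carrier := {u | P.IsSolution lam u}
  zero_mem' := by
    have h : P.quasiDeriv 0 = 0 := by funext x; simp [quasiDeriv]
    refine ⟨fun _ _ => rfl, differentiableOn_const 0, ?_, ?_, ?_⟩
    · rw [h]; exact differentiableOn_const 0
    · simp [SatisfiesBC, h]
    · intro x _
      simp [expr, h]
  add_mem' := by
    rintro u v hu hv
    have h := P.quasiDeriv_add hu.diff hv.diff
    refine ⟨fun x hx => ?_, hu.diff.add hv.diff, ?_, ?_, fun x hx => ?_⟩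
    · simp [hu.zero_outside x hx, hv.zero_outside x hx]
    · rw [h]; exact hu.diff_quasi.add hv.diff_quasi
    · have h1 := hu.bc
      have h2 := hv.bc
      simp only [SatisfiesBC, h, Pi.add_apply] at h1 h2 ⊢
      have e : ∀ s t s' t' : ℂ, (![s + s', t + t'] : Fin 2 → ℂ) = ![s, t] + ![s', t'] := by
        intros; simp
      rw [e, e, Matrix.mulVec_add, Matrix.mulVec_add, add_add_add_comm, h1, h2, add_zero]
    · have h1 := hu.eqn x hx
      have h2 := hv.eqn x hx
      simp only [expr, h] at h1 h2 ⊢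
      rw [derivWithin_add (hu.diff_quasi x hx) (hv.diff_quasi x hx)]
      simp only [Pi.add_apply]
      linear_combination h1 + h2
  smul_mem' := by
    rintro c u hu
    have h := P.quasiDeriv_smul c u
    refine ⟨fun x hx => ?_, hu.diff.const_smul c, ?_, ?_, fun x hx => ?_⟩
    · simp [hu.zero_outside x hx]
    · rw [h]; exact hu.diff_quasi.const_smul c
    · have h1 := hu.bc
      simp only [SatisfiesBC, h, Pi.smul_apply, smul_eq_mul] at h1 ⊢
      have e : ∀ s t : ℂ, (![c * s, c * t] : Fin 2 → ℂ) = c • ![s, t] := by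
        intros; simp
      rw [e, e, Matrix.mulVec_smul, Matrix.mulVec_smul, ← smul_add, h1, smul_zero]
    · have h1 := hu.eqn x hx
      simp only [expr, h] at h1 ⊢
      rw [derivWithin_const_smul_field]
      simp only [Pi.smul_apply, smul_eq_mul]
      linear_combination c * h1

/-- The number of eigenvalues in `[0, t]`, counted with multiplicity. -/
def count (P : SturmLiouville) (t : ℝ) : ℕ :=
  ∑ᶠ s ∈ Set.Icc (0 : ℝ) t, Module.finrank ℂ (P.eigenspace s)

/-- `λ_k(ℒ)`: the `k`-th non-negative eigenvalue (`k ≥ 1`), counted with multiplicity. -/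
def eig (P : SturmLiouville) (k : ℕ) : ℝ := kthNonneg P.count k

/-! ### Liouville normal form -/

/-- The Liouville variable `y(x) = ∫ₐˣ √(w/p)`. -/
def liouvilleVar (P : SturmLiouville) (x : ℝ) : ℝ :=
  ∫ t in P.a..x, √(P.w t / P.p t)

/-- The length `B = ∫ₐᵇ √(w/p)`. -/
def B (P : SturmLiouville) : ℝ := ∫ t in P.a..P.b, √(P.w t / P.p t)

/-- The Liouville weight `m = (p w)^{1/4}`; the transformation is `u(x) = v(y(x)) / m(x)`. -/
def weight (P : SturmLiouville) (x : ℝ) : ℝ := (P.p x * P.w x) ^ (1 / 4 : ℝ)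

/-- Differentiation with respect to `y`, written in the variable `x`: `d/dy = √(p/w) d/dx`. -/
def derivY (P : SturmLiouville) (f : ℝ → ℝ) (x : ℝ) : ℝ :=
  √(P.p x / P.w x) * derivWithin f P.dom x

/-- The potential `V = q/w + m⁻¹ d²m/dy²` of the normal form, as a function of `y ∈ [0, B]`. -/
def potential (P : SturmLiouville) (y : ℝ) : ℝ :=
  let x := Function.invFunOn P.liouvilleVar P.dom y
  P.q x / P.w x + P.derivY (P.derivY P.weight) x / P.weight x

/-- The matrix `T(x)` with `(u, p u')ᵀ (x) = T(x) (v, dv/dy)ᵀ (y(x))` when `u = v / m`. -/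
def transition (P : SturmLiouville) (x : ℝ) : Matrix (Fin 2) (Fin 2) ℂ :=
  !![((1 / P.weight x : ℝ) : ℂ), 0;
    ((-(P.p x * derivWithin P.weight P.dom x / P.weight x ^ 2) : ℝ) : ℂ), (P.weight x : ℂ)]

/-- The Liouville normal form `v ↦ -v'' + V v` on `[0, B]`, with the transformed boundary
conditions. -/
def normalForm (P : SturmLiouville) : SturmLiouville where
  a := 0
  b := P.B
  p := fun _ => 1
  q := P.potential
  w := fun _ => 1
  bcL := P.bcL * P.transition P.a
  bcR := P.bcR * P.transition P.b

end SturmLiouville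

/-! ### Matrix sequences, spectral symbols and rearrangements -/

/-- All eigenvalues of the matrix are real. -/
def HasRealEigenvalues {N : ℕ} (X : Matrix (Fin N) (Fin N) ℂ) : Prop :=
  ∀ z ∈ X.charpoly.roots, z.im = 0

/-- `λ_k(X)`: the `k`-th non-negative eigenvalue (`k ≥ 1`), counted with algebraic multiplicity,
of a matrix with real eigenvalues. -/
def matrixEig {N : ℕ} (X : Matrix (Fin N) (Fin N) ℂ) (k : ℕ) : ℝ :=
  kthNonneg (fun t => ((X.charpoly.roots.map Complex.re).filter (· ∈ Set.Icc 0 t)).card) k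

/-- `{X_n} ∼_λ ω` on `D`, for matrices `X_n` of order `d n` with real eigenvalues and a
real-valued `ω`. -/
def HasSpectralSymbol (d : ℕ → ℕ) (X : (n : ℕ) → Matrix (Fin (d n)) (Fin (d n)) ℂ)
    (D : Set (ℝ × ℝ)) (ω : ℝ × ℝ → ℝ) : Prop :=
  ∀ F : ℝ → ℝ, Continuous F → HasCompactSupport F →
    Tendsto (fun n => (1 / (d n : ℝ)) * ((X n).charpoly.roots.map (fun z => F z.re)).sum) atTop
      (𝓝 ((1 / volume.real D) * ∫ y in D, F (ω y)))

/-- The essential range `R_ω` of `ω` on `D`. -/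
def essRange (D : Set (ℝ × ℝ)) (ω : ℝ × ℝ → ℝ) : Set ℝ :=
  {t | ∀ ε > 0, 0 < volume {y ∈ D | |ω y - t| < ε}}

/-- The distribution function `φ_ω(t) = m{y ∈ D : ω(y) ≤ t} / m(D)`. -/
def distFun (D : Set (ℝ × ℝ)) (ω : ℝ × ℝ → ℝ) (t : ℝ) : ℝ :=
  (1 / volume.real D) * volume.real {y ∈ D | ω y ≤ t}

/-- The monotone rearrangement `ω*(x) = inf {t ∈ R_ω : φ_ω(t) > x}`, for `0 < x < 1`. -/
def rearrangement (D : Set (ℝ × ℝ)) (ω : ℝ × ℝ → ℝ) (x : ℝ) : ℝ :=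
  sInf {t | t ∈ essRange D ω ∧ x < distFun D ω t}

/-- The rectangle `[a, b] × [-π, π]`. -/
def symbolDomain (P : SturmLiouville) : Set (ℝ × ℝ) :=
  Set.Icc P.a P.b ×ˢ Set.Icc (-Real.pi) Real.pi

/-- The relative error `|(N + 1)² s / lam - 1|` between the scaled sample `(N + 1)² s` and the
eigenvalue `lam`. -/
def samplingError (N : ℕ) (s lam : ℝ) : ℝ :=
  |((N : ℝ) + 1) ^ 2 * s / lam - 1|

end

noncomputable section

/-! ### Operators with compact self-adjoint resolvent -/

section Parseval

variable {H : Type*} [NormedAddCommGroup H] [InnerProductSpace ℂ H] [CompleteSpace H]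

/-! For fixed `k` the points `k / (d_n + 1)` tend to `0` from the right, so assumption (c) alone
gives `(d_n + 1)² ω*(k / (d_n + 1)) → k²π²/B²`. With `λ_k(L_n) → λ_k(ℒ) = λ_k(ℒ_V) ≠ 0`, every limit
in the statement is the limit of a quotient, and its value contains no `η`. Two analytic facts
remain: the Liouville transformation preserves eigenvalues with multiplicity (`eigenspaceEquiv`),
and `c_k → 0`, which is Weyl's law `λ_k(ℒ_V) ~ k²π²/B²` for a continuous potential and arbitrary
self-adjoint boundary conditions.

Weyl's law follows from a counting estimate: the number of eigenvalues in `[0, t]` is `B√t/π + O(1)`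
(`exists_count_bound`). The reference operator is the Dirichlet Laplacian, whose eigenvalues
`(kπ/B)²` are simple and explicit. The two operators share the functions whose value and derivative
vanish at both ends. This subspace is cut out by four linear conditions, and on it the operators
differ by multiplication by the bounded `V`. The abstract principle
(`HasCompactResolvent.finrank_le`) is of Glazman type for windows `[c - r, c + r]`: too many
eigenvalues of one operator in a window would yield a nonzero vector in its spectral subspace that
satisfies the four conditions and is orthogonal to the spectral subspace of the other operator for a
slightly larger window. The two resulting bounds on the distance to `c` contradict each other.
Windows make any semiboundedness argument unnecessary.

The principle needs the spectral theorem, hence a compact symmetric resolvent at some real point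
(`exists_hasCompactResolvent`). A real non-eigenvalue exists because `L²` is separable; the
resolvent is then the integral operator of Green's function, built by variation of constants,
compact by Arzelà–Ascoli, and symmetric by Green's identity. The boundary terms in that identity
cancel because the admissible boundary values form an isotropic subspace, which is what `MEM* =
NEN*` together with rank two expresses (`isotropicBC_of_selfAdjoint`). -/

instance completeSpace_eigenspace (T : H →L[ℂ] H) (ν : ℂ) :
    CompleteSpace (Module.End.eigenspace (T : Module.End ℂ H) ν) := by
  have : IsClosed ((Module.End.eigenspace (T : Module.End ℂ H) ν : Submodule ℂ H) : Set H) := by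
    have h : ((Module.End.eigenspace (T : Module.End ℂ H) ν : Submodule ℂ H) : Set H) =
        {x | T x = ν • x} := by
      ext x; simp
    rw [h]
    exact isClosed_eq T.continuous (continuous_const_smul ν)
  exact this.completeSpace_coe

/-- The orthogonal projection onto the eigenspace of a bounded operator. -/
def eigenProj (T : H →L[ℂ] H) (ν : ℂ) : H →L[ℂ] H :=
  (Module.End.eigenspace (T : Module.End ℂ H) ν).starProjection

theorem eigenProj_mem (T : H →L[ℂ] H) (ν : ℂ) (x : H) : T (eigenProj T ν x) = ν • eigenProj T ν x := by
  have h := Submodule.starProjection_apply_mem (Module.End.eigenspace (T : Module.End ℂ H) ν) x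
  exact Module.End.mem_eigenspace_iff.1 h

theorem eigenProj_eq_of_forall_inner {T : H →L[ℂ] H} {ν : ℂ} {x v : H} (hv : T v = ν • v)
    (h : ∀ w, T w = ν • w → inner ℂ (x - v) w = 0) : eigenProj T ν x = v :=
  Submodule.eq_starProjection_of_mem_of_inner_eq_zero (Module.End.mem_eigenspace_iff.2 hv)
    fun w hw => h w (Module.End.mem_eigenspace_iff.1 hw)

theorem inner_sub_eigenProj {T : H →L[ℂ] H} {ν : ℂ} (x : H) {w : H} (hw : T w = ν • w) :
    inner ℂ (x - eigenProj T ν x) w = 0 :=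
  Submodule.starProjection_inner_eq_zero x w (Module.End.mem_eigenspace_iff.2 hw)

theorem eigenProj_apply_map {T : H →L[ℂ] H} (hT : T.IsSymmetric) (ν : ℂ) (x : H) :
    eigenProj T ν (T x) = ν • eigenProj T ν x := by
  refine eigenProj_eq_of_forall_inner ?_ fun w hw => ?_
  · rw [map_smul, eigenProj_mem]
  · by_cases hw0 : w = 0
    · simp [hw0]
    have hν : (starRingEnd ℂ) ν = ν :=
      LinearMap.IsSymmetric.conj_eigenvalue_eq_self (T := (T : H →ₗ[ℂ] H)) hT
        (Module.End.hasEigenvalue_of_hasEigenvector ⟨Module.End.mem_eigenspace_iff.2 hw, hw0⟩)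
    have h1 : inner ℂ (T x) w = inner ℂ x (T w) := hT x w
    have h2 := inner_sub_eigenProj x hw
    rw [inner_sub_left] at h2 ⊢
    rw [h1, hw, inner_smul_right, inner_smul_left, hν, ← mul_sub, h2, mul_zero]

/-- Parseval's identity for the spectral theorem: the eigenspaces, including the kernel at `ν = 0`,
form an orthogonal Hilbert sum, whose coordinates are the orthogonal projections. Norm estimates for
an operator thereby reduce to estimates on each eigenspace. -/
theorem hasSum_sq_norm_eigenProj {T : H →L[ℂ] H} (hc : IsCompactOperator T) (hT : T.IsSymmetric)
    (x : H) : HasSum (fun ν => ‖eigenProj T ν x‖ ^ 2) (‖x‖ ^ 2) := by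
  have hfam := LinearMap.IsSymmetric.orthogonalFamily_eigenspaces (T := (T : H →ₗ[ℂ] H)) hT
  have htop : ⊤ ≤ (⨆ ν, Module.End.eigenspace (T : Module.End ℂ H) ν).topologicalClosure := by
    rw [← Submodule.orthogonal_orthogonal_eq_closure,
      ContinuousLinearMap.orthogonalComplement_iSup_eigenspaces_eq_bot hc hT,
      Submodule.bot_orthogonal_eq_top]
  have hS := IsHilbertSum.mkInternal _ hfam htop
  set e := hS.linearIsometryEquiv
  have key : ∀ ν, ((e x : ∀ ν, Module.End.eigenspace (T : Module.End ℂ H) ν) ν : H)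
      = eigenProj T ν x := by
    intro ν
    classical
    symm
    refine eigenProj_eq_of_forall_inner (Module.End.mem_eigenspace_iff.1 (Subtype.mem _)) ?_
    intro w hw
    have hw' := Module.End.mem_eigenspace_iff.2 hw
    have h1 : e.symm (lp.single 2 ν ⟨w, hw'⟩) = w := by
      rw [IsHilbertSum.linearIsometryEquiv_symm_apply_single]; rfl
    have h2 : inner ℂ x w = inner ℂ (e x) (lp.single 2 ν ⟨w, hw'⟩ :
        lp (fun ν => Module.End.eigenspace (T : Module.End ℂ H) ν) 2) := by
      rw [← e.inner_map_map x w]; congr 1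
      exact e.symm.injective (by rw [e.symm_apply_apply]; exact h1.symm)
    rw [lp.inner_single_right] at h2
    rw [inner_sub_left, h2]
    simp
  have := lp.hasSum_norm (p := 2) (by simp) (e x)
  simp only [ENNReal.toReal_ofNat, Real.rpow_two, LinearIsometryEquiv.norm_map] at this
  convert this using 2 with ν
  rw [← key ν]; rfl

theorem norm_le_mul_norm_of_eigenProj {T : H →L[ℂ] H} (hc : IsCompactOperator T)
    (hT : T.IsSymmetric) {x y : H} {r : ℝ} (hr : 0 ≤ r)
    (h : ∀ ν, ‖eigenProj T ν x‖ ≤ r * ‖eigenProj T ν y‖) : ‖x‖ ≤ r * ‖y‖ := by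
  have h1 := hasSum_sq_norm_eigenProj hc hT x
  have h2 := (hasSum_sq_norm_eigenProj hc hT y).mul_left (r ^ 2)
  have h3 := hasSum_le (fun ν => ?_) h1 h2
  · rw [← mul_pow] at h3
    exact le_of_sq_le_sq h3 (by positivity)
  · rw [← mul_pow]
    exact pow_le_pow_left₀ (norm_nonneg _) (h ν) 2

theorem mul_norm_le_norm_of_eigenProj {T : H →L[ℂ] H} (hc : IsCompactOperator T)
    (hT : T.IsSymmetric) {x y : H} {r : ℝ} (hr : 0 ≤ r)
    (h : ∀ ν, r * ‖eigenProj T ν x‖ ≤ ‖eigenProj T ν y‖) : r * ‖x‖ ≤ ‖y‖ := by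
  have h1 := (hasSum_sq_norm_eigenProj hc hT x).mul_left (r ^ 2)
  have h2 := hasSum_sq_norm_eigenProj hc hT y
  have h3 := hasSum_le (fun ν => ?_) h1 h2
  · rw [← mul_pow] at h3
    exact le_of_sq_le_sq h3 (norm_nonneg _)
  · rw [← mul_pow]
    exact pow_le_pow_left₀ (by positivity) (h ν) 2

end Parseval

/-! ### Dimension counts for independent families of subspaces -/

section FinrankSup

variable {K V ι : Type*} [DivisionRing K] [AddCommGroup V] [Module K V]

theorem iSupIndep.finrank_biSup_finset {p : ι → Submodule K V} (hp : iSupIndep p) (s : Finset ι)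
    (hfin : ∀ i ∈ s, FiniteDimensional K (p i)) :
    FiniteDimensional K (⨆ i ∈ s, p i : Submodule K V) ∧
    Module.finrank K (⨆ i ∈ s, p i : Submodule K V) = ∑ i ∈ s, Module.finrank K (p i) := by
  classical
  induction s using Finset.induction_on with
  | empty =>
    have : (⨆ i ∈ (∅ : Finset ι), p i) = ⊥ := by simp
    rw [this]
    exact ⟨inferInstance, by simp⟩
  | insert a s ha ih =>
    obtain ⟨h3, ih⟩ := ih fun i hi => hfin i (Finset.mem_insert_of_mem hi)
    have h2 : FiniteDimensional K (p a) := hfin a (Finset.mem_insert_self _ _)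
    have hdisj : Disjoint (p a) (⨆ i ∈ s, p i) := by
      refine (hp a).mono_right (iSup₂_le fun i hi => ?_)
      exact le_iSup₂_of_le i (fun h => ha (h ▸ hi)) le_rfl
    have h4 := Submodule.finrank_sup_add_finrank_inf_eq (p a) (⨆ i ∈ s, p i)
    rw [hdisj.eq_bot, finrank_bot, add_zero] at h4
    rw [Finset.iSup_insert, h4, Finset.sum_insert ha, ih]
    exact ⟨inferInstance, rfl⟩

/-- An independent family inside a finite-dimensional space has only finitely many nonzero members.
This matters because `finsum` takes the value `0` on an infinite support, so that an eigenvalue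
count written with it would otherwise be meaningless. -/
theorem iSupIndep.finsum_finrank {p : ι → Submodule K V} (hp : iSupIndep p) (S : Set ι)
    [hfin : FiniteDimensional K (⨆ i ∈ S, p i : Submodule K V)] :
    {i ∈ S | p i ≠ ⊥}.Finite ∧
    ∑ᶠ i ∈ S, Module.finrank K (p i) = Module.finrank K (⨆ i ∈ S, p i : Submodule K V) := by
  classical
  have hle : ∀ i ∈ S, p i ≤ ⨆ i ∈ S, p i := fun i hi => le_iSup₂_of_le i hi le_rfl
  have hfd : ∀ i ∈ S, FiniteDimensional K (p i) := fun i hi =>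
    Submodule.finiteDimensional_of_le (hle i hi)
  have hfinite : {i ∈ S | p i ≠ ⊥}.Finite := by
    set W := (⨆ i ∈ S, p i : Submodule K V)
    let q : S → Submodule K W := fun i => (p i).comap W.subtype
    have hq : iSupIndep q := by
      have hp' : iSupIndep (fun i : S => p i) := hp.comp Subtype.val_injective
      intro i
      rw [Submodule.disjoint_def]
      intro x hx hx'
      have hx'' : (x : V) ∈ ⨆ j, ⨆ (_ : j ≠ i), p j := by
        have : ((⨆ j, ⨆ (_ : j ≠ i), q j).map W.subtype) ≤ ⨆ j, ⨆ (_ : j ≠ i), p (j : S) := by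
          simp only [Submodule.map_iSup]
          exact iSup₂_mono fun j _ => Submodule.map_comap_le _ _
        exact this (Submodule.mem_map_of_mem hx')
      exact Subtype.ext ((Submodule.disjoint_def.1 (hp' i)) x hx hx'')
    have h1 := WellFoundedGT.finite_ne_bot_of_iSupIndep hq
    refine (h1.image Subtype.val).subset ?_
    rintro i ⟨hi, hi'⟩
    refine ⟨⟨i, hi⟩, ?_, rfl⟩
    intro h
    apply hi'
    rw [eq_bot_iff]
    intro x hx
    have : (⟨x, hle i hi hx⟩ : W) ∈ q ⟨i, hi⟩ := hx
    rw [h] at this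
    simpa using this
  refine ⟨hfinite, ?_⟩
  have e1 : (⨆ i ∈ S, p i) = ⨆ i ∈ hfinite.toFinset, p i := by
    refine le_antisymm (iSup₂_le fun i hi => ?_) (iSup₂_le fun i hi => ?_)
    · by_cases h : p i = ⊥
      · rw [h]; exact bot_le
      · exact le_iSup₂_of_le i (by simp [hi, h]) le_rfl
    · exact hle i (hfinite.mem_toFinset.1 hi).1
  rw [e1, (hp.finrank_biSup_finset _ fun i hi => hfd i (hfinite.mem_toFinset.1 hi).1).2]
  rw [finsum_mem_eq_sum_of_inter_support_eq]
  ext i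
  simp only [Set.mem_inter_iff, Function.mem_support, Set.Finite.coe_toFinset, Set.mem_ofPred_eq]
  constructor
  · rintro ⟨h1, h2⟩
    exact ⟨⟨h1, fun h => h2 (by rw [h, finrank_bot])⟩, h2⟩
  · rintro ⟨⟨h1, _⟩, h2⟩
    exact ⟨h1, h2⟩

end FinrankSup

/-! ### Spectral subspaces of operators with compact resolvent, and their comparison -/

section Resolvent

variable {Y H : Type*} [AddCommGroup Y] [Module ℂ Y] [NormedAddCommGroup H] [InnerProductSpace ℂ H]

/-- The operator `val y ↦ op y` has the compact self-adjoint resolvent `T` at the real point `μ`. -/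
structure HasCompactResolvent (val op : Y →ₗ[ℂ] H) (T : H →L[ℂ] H) (μ : ℝ) : Prop where
  injective : Function.Injective val
  isCompact : IsCompactOperator T
  isSymmetric : T.IsSymmetric
  left_inv : ∀ y, T (op y - (μ : ℂ) • val y) = val y
  eigenvector : ∀ (g : H) (ν : ℂ), ν ≠ 0 → T g = ν • g →
    ∃ y, val y = g ∧ op y = ((μ : ℂ) + ν⁻¹) • g

/-- The eigenspace of the operator `val y ↦ op y` at a real number. -/
def eigSub (val op : Y →ₗ[ℂ] H) (lam : ℝ) : Submodule ℂ Y := LinearMap.ker (op - (lam : ℂ) • val)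

/-- The sum of the eigenspaces with eigenvalue in a given set. -/
def spectralSub (val op : Y →ₗ[ℂ] H) (S : Set ℝ) : Submodule ℂ Y := ⨆ lam ∈ S, eigSub val op lam

variable {val op : Y →ₗ[ℂ] H}

theorem mem_eigSub {lam : ℝ} {y : Y} : y ∈ eigSub val op lam ↔ op y = (lam : ℂ) • val y := by
  simp [eigSub, sub_eq_zero]

theorem injective_of_eigSub {lam : ℝ} {φ : eigSub val op lam →ₗ[ℂ] ℂ}
    (h : ∀ z, φ z = 0 → z = 0) : Function.Injective φ :=
  (injective_iff_map_eq_zero φ).2 h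

theorem eq_of_eigSub_eq_bot {μ : ℝ} (h : eigSub val op μ = ⊥) {y z : Y}
    (hyz : op y - (μ : ℂ) • val y = op z - (μ : ℂ) • val z) : y = z := by
  have e : y - z ∈ eigSub val op μ := by
    rw [mem_eigSub, map_sub, map_sub, smul_sub, sub_eq_sub_iff_sub_eq_sub, hyz]
  rwa [h, Submodule.mem_bot, sub_eq_zero] at e

theorem eigSub_le_spectralSub {S : Set ℝ} {lam : ℝ} (h : lam ∈ S) :
    eigSub val op lam ≤ spectralSub val op S :=
  le_iSup₂_of_le lam h le_rfl

theorem spectralSub_mono {S S' : Set ℝ} (h : S ⊆ S') :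
    spectralSub val op S ≤ spectralSub val op S' :=
  iSup₂_le fun _ hl => eigSub_le_spectralSub (h hl)

theorem spectralSub_induction {S : Set ℝ} {motive : Y → Prop} {y : Y}
    (hy : y ∈ spectralSub val op S)
    (mem : ∀ lam ∈ S, ∀ y, op y = (lam : ℂ) • val y → motive y) (zero : motive 0)
    (add : ∀ x y, motive x → motive y → motive (x + y)) : motive y := by
  unfold spectralSub at hy
  rw [← iSup_subtype''] at hy
  exact Submodule.iSup_induction _ (motive := motive) hy (fun i x hx => mem i i.2 x (mem_eigSub.1 hx)) zero add

variable {T : H →L[ℂ] H} {μ : ℝ}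

theorem HasCompactResolvent.map_val (h : HasCompactResolvent val op T μ) {lam : ℝ} {y : Y}
    (hy : op y = (lam : ℂ) • val y) : ((lam : ℂ) - μ) • T (val y) = val y := by
  have := h.left_inv y
  rwa [hy, ← sub_smul, map_smul] at this

theorem HasCompactResolvent.inner_eq_zero (h : HasCompactResolvent val op T μ) {l₁ l₂ : ℝ}
    (hne : l₁ ≠ l₂) {x y : Y} (hx : op x = (l₁ : ℂ) • val x) (hy : op y = (l₂ : ℂ) • val y) :
    inner ℂ (val x) (val y) = 0 := by
  have h1 : inner ℂ (T (val x)) (val y) = inner ℂ (val x) (T (val y)) := h.isSymmetric _ _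
  have h2 := congrArg (inner ℂ (val x)) (h.map_val hy)
  have h3 := congrArg (fun z => inner ℂ z (val y)) (h.map_val hx)
  simp only [inner_smul_left, inner_smul_right, map_sub, Complex.conj_ofReal] at h2 h3
  have h4 : ((l₁ : ℂ) - l₂) * inner ℂ (val x) (val y) = 0 := by
    linear_combination (l₂ - μ : ℂ) * h3 - (l₁ - μ : ℂ) * h2 + (l₂ - μ : ℂ) * (μ - l₁) * h1
  have h5 : (l₁ : ℂ) - l₂ ≠ 0 := by
    rw [sub_ne_zero]; exact_mod_cast hne
  exact (mul_eq_zero.1 h4).resolve_left h5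

theorem HasCompactResolvent.iSupIndep (h : HasCompactResolvent val op T μ) :
    iSupIndep (eigSub val op) := by
  have hfam : OrthogonalFamily ℂ (fun l => (eigSub val op l).map val)
      fun l => ((eigSub val op l).map val).subtypeₗᵢ := by
    rintro l₁ l₂ hne ⟨_, x, hx, rfl⟩ ⟨_, y, hy, rfl⟩
    exact h.inner_eq_zero hne (mem_eigSub.1 hx) (mem_eigSub.1 hy)
  intro l
  rw [Submodule.disjoint_def]
  intro x hx hx'
  have h1 := Submodule.mem_map_of_mem (f := val) hx'
  simp only [Submodule.map_iSup] at h1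
  have h2 := (Submodule.disjoint_def.1 (hfam.independent l)) _ (Submodule.mem_map_of_mem hx) h1
  exact h.injective (by rw [h2, map_zero])

variable [CompleteSpace H]

/-- On the `ν`-component the operator acts as `μ + ν⁻¹`. The form without division also covers `ν =
0`, where it says that elements of the domain have no component in the kernel of `T`. -/
theorem HasCompactResolvent.eigenProj_val (h : HasCompactResolvent val op T μ) (ν : ℂ) (y : Y) :
    eigenProj T ν (val y) = ν • (eigenProj T ν (op y) - (μ : ℂ) • eigenProj T ν (val y)) := by
  conv_lhs => rw [← h.left_inv y]
  rw [eigenProj_apply_map h.isSymmetric, map_sub, map_smul]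

/-- Only the eigenvalue `lam` with `ν (lam - μ) = 1` can contribute to the `ν`-component, and there
is at most one. If none lies in `S`, the component vanishes. -/
theorem HasCompactResolvent.eigenProj_op_of_mem (h : HasCompactResolvent val op T μ) {S : Set ℝ}
    {y : Y} (hy : y ∈ spectralSub val op S) (ν : ℂ) :
    (∃ lam ∈ S, eigenProj T ν (op y) = (lam : ℂ) • eigenProj T ν (val y)) ∨
      (eigenProj T ν (op y) = 0 ∧ eigenProj T ν (val y) = 0) := by
  have key : ∀ lam : ℝ, ∀ y, op y = (lam : ℂ) • val y → ν * (lam - μ) ≠ 1 →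
      eigenProj T ν (val y) = 0 := by
    intro lam y hy hne
    have h1 := h.eigenProj_val ν y
    rw [hy, map_smul, ← sub_smul, smul_smul] at h1
    have h2 : (1 - ν * (lam - μ)) • eigenProj T ν (val y) = 0 := by
      rw [sub_smul, one_smul, ← h1, sub_self]
    exact (smul_eq_zero.1 h2).resolve_left (sub_ne_zero.2 hne.symm)
  by_cases hex : ∃ lam ∈ S, ν * ((lam : ℂ) - μ) = 1
  · obtain ⟨lam, hlam, h1⟩ := hex
    refine Or.inl ⟨lam, hlam, ?_⟩
    refine spectralSub_induction (motive := fun y =>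
      eigenProj T ν (op y) = (lam : ℂ) • eigenProj T ν (val y)) hy ?_ (by simp) ?_
    · intro l hl y hy
      by_cases hll : l = lam
      · rw [hy, hll, map_smul]
      · rw [hy, map_smul, key l y hy, smul_zero, smul_zero]
        intro h2
        apply hll
        have h3 : ν * ((l : ℂ) - μ) = ν * (lam - μ) := by rw [h1, h2]
        have hν : ν ≠ 0 := by rintro rfl; simp at h1
        have h4 := mul_left_cancel₀ hν h3
        exact_mod_cast sub_left_injective h4
    · intro x y hx hy
      simp only [map_add, hx, hy, smul_add]
  · push Not at hex
    refine Or.inr ?_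
    refine spectralSub_induction (motive := fun y =>
      eigenProj T ν (op y) = 0 ∧ eigenProj T ν (val y) = 0) hy ?_ (by simp) ?_
    · intro l hl y hy
      have := key l y hy (hex l hl)
      rw [hy, map_smul, this, smul_zero]
      exact ⟨rfl, rfl⟩
    · rintro x y ⟨h1, h2⟩ ⟨h3, h4⟩
      simp [h1, h2, h3, h4]

theorem HasCompactResolvent.norm_sub_le (h : HasCompactResolvent val op T μ) {c r : ℝ}
    (hr : 0 ≤ r) {y : Y} (hy : y ∈ spectralSub val op (Set.Icc (c - r) (c + r))) :
    ‖op y - (c : ℂ) • val y‖ ≤ r * ‖val y‖ := by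
  refine norm_le_mul_norm_of_eigenProj h.isCompact h.isSymmetric hr fun ν => ?_
  rw [map_sub, map_smul]
  rcases h.eigenProj_op_of_mem hy ν with ⟨lam, hlam, h1⟩ | ⟨h1, h2⟩
  · rw [h1, ← sub_smul, norm_smul]
    gcongr
    rw [← Complex.ofReal_sub, Complex.norm_real, Real.norm_eq_abs, abs_le]
    constructor <;> linarith [hlam.1, hlam.2]
  · simp [h1, h2]

/-- If a nonzero `ν`-component belonged to an eigenvalue `μ + ν⁻¹` at distance less than `r` from
`c`, that component would itself lie in the spectral subspace of the window. Orthogonality would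
then force it to vanish. -/
theorem HasCompactResolvent.le_norm_sub (h : HasCompactResolvent val op T μ) {c r : ℝ}
    (hr : 0 ≤ r) {y : Y}
    (hy : ∀ w ∈ spectralSub val op (Set.Icc (c - r) (c + r)), inner ℂ (val y) (val w) = 0) :
    r * ‖val y‖ ≤ ‖op y - (c : ℂ) • val y‖ := by
  refine mul_norm_le_norm_of_eigenProj h.isCompact h.isSymmetric hr fun ν => ?_
  by_cases h0 : eigenProj T ν (val y) = 0
  · rw [h0]; simp
  have h1 := h.eigenProj_val ν y
  have hν : ν ≠ 0 := by
    rintro rfl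
    rw [zero_smul] at h1
    exact h0 h1
  have hT := eigenProj_mem T ν (val y)
  have hreal : (starRingEnd ℂ) ν = ν :=
    LinearMap.IsSymmetric.conj_eigenvalue_eq_self (T := (T : H →ₗ[ℂ] H)) h.isSymmetric
      (Module.End.hasEigenvalue_of_hasEigenvector ⟨Module.End.mem_eigenspace_iff.2 hT, h0⟩)
  obtain ⟨s, rfl⟩ := Complex.conj_eq_iff_real.1 hreal
  have hs : s ≠ 0 := by exact_mod_cast hν
  have h2 : eigenProj T s (op y) = ((μ + s⁻¹ : ℝ) : ℂ) • eigenProj T s (val y) := by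
    have : ((s : ℂ)⁻¹) • eigenProj T s (val y) =
        eigenProj T s (op y) - (μ : ℂ) • eigenProj T s (val y) := by
      conv_lhs => rw [h1]
      rw [smul_smul, inv_mul_cancel₀ hν, one_smul]
    push_cast
    rw [add_smul, this]; abel
  rw [map_sub, map_smul, h2, ← sub_smul, norm_smul]
  gcongr
  rw [← Complex.ofReal_sub, Complex.norm_real, Real.norm_eq_abs]
  by_contra! hlt
  obtain ⟨w, hw, hw'⟩ := h.eigenvector _ _ hν hT
  have hmem : w ∈ spectralSub val op (Set.Icc (c - r) (c + r)) := by
    refine eigSub_le_spectralSub (lam := μ + s⁻¹) ?_ (mem_eigSub.2 ?_)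
    · rw [abs_lt] at hlt
      constructor <;> linarith
    · rw [hw', hw]; push_cast; rfl
  have h3 := hy w hmem
  have h4 := inner_sub_eigenProj (val y) hT
  rw [hw] at h3
  rw [inner_sub_left, h3, zero_sub, neg_eq_zero, inner_self_eq_zero] at h4
  exact h0 h4

/-- On the spectral subspace of a bounded set the operator is bounded, so a bounded sequence in it
is the image under the compact `T` of a bounded sequence. In infinite dimension Riesz's lemma would
supply a bounded sequence with mutual distances at least one, which has no convergent subsequence.
-/
theorem HasCompactResolvent.finiteDimensional (h : HasCompactResolvent val op T μ) {S : Set ℝ}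
    (hS : Bornology.IsBounded S) : FiniteDimensional ℂ (spectralSub val op S) := by
  obtain ⟨r, hr0, hr⟩ := hS.subset_closedBall_lt 0 0
  rw [Real.closedBall_eq_Icc] at hr
  set W := spectralSub val op S
  suffices hfd : FiniteDimensional ℂ (W.map val) by
    exact LinearEquiv.finiteDimensional (W.equivMapOfInjective val h.injective).symm
  by_contra hinf
  obtain ⟨R, f, hR, hf, hsep⟩ := exists_seq_norm_le_one_le_norm_sub (𝕜 := ℂ) hinf
  have hy : ∀ n, ∃ y ∈ W, val y = f n := fun n => (f n).2
  choose y hyW hyf using hy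
  set x : ℕ → H := fun n => op (y n) - (μ : ℂ) • val (y n)
  have hx : ∀ n, x n ∈ Metric.closedBall (0 : H) ((r + |μ|) * R) := by
    intro n
    rw [mem_closedBall_zero_iff]
    have h1 : ‖op (y n) - ((0 : ℝ) : ℂ) • val (y n)‖ ≤ r * ‖val (y n)‖ :=
      h.norm_sub_le hr0.le (spectralSub_mono hr (hyW n))
    have h2 : ‖val (y n)‖ ≤ R := by rw [hyf]; exact hf n
    simp only [Complex.ofReal_zero, zero_smul, sub_zero] at h1
    calc ‖x n‖ ≤ ‖op (y n)‖ + ‖(μ : ℂ) • val (y n)‖ := _root_.norm_sub_le _ _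
      _ ≤ r * ‖val (y n)‖ + |μ| * ‖val (y n)‖ := by
          rw [norm_smul, Complex.norm_real, Real.norm_eq_abs]; linarith
      _ = (r + |μ|) * ‖val (y n)‖ := by ring
      _ ≤ (r + |μ|) * R := by gcongr
  have hTx : ∀ n, T (x n) = f n := fun n => by rw [← hyf, ← h.left_inv (y n)]
  have hcpt := h.isCompact.isCompact_closure_image_closedBall (f := (T : H →ₗ[ℂ] H))
    ((r + |μ|) * R)
  obtain ⟨a, -, φ, hφ, hlim⟩ := hcpt.tendsto_subseq (x := fun n => (f n : H))
    fun n => subset_closure ⟨x n, hx n, hTx n⟩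
  have hcau := hlim.cauchySeq
  rw [Metric.cauchySeq_iff'] at hcau
  obtain ⟨N, hN⟩ := hcau 1 one_pos
  have h1 := hN (N + 1) (Nat.le_succ N)
  have h2 := hsep (hφ (Nat.lt_succ_self N)).ne'
  rw [dist_eq_norm] at h1
  exact absurd h2 (not_le.2 h1)

theorem HasCompactResolvent.finsum_finrank (h : HasCompactResolvent val op T μ) {S : Set ℝ}
    (hS : Bornology.IsBounded S) :
    ∑ᶠ l ∈ S, Module.finrank ℂ (eigSub val op l) = Module.finrank ℂ (spectralSub val op S) := by
  have := h.finiteDimensional hS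
  unfold spectralSub at this
  exact (h.iSupIndep.finsum_finrank S).2

theorem HasCompactResolvent.finrank_union (h : HasCompactResolvent val op T μ) {S S' : Set ℝ}
    (hS : Bornology.IsBounded S) (hS' : Bornology.IsBounded S') :
    Module.finrank ℂ (spectralSub val op (S ∪ S')) ≤
      Module.finrank ℂ (spectralSub val op S) + Module.finrank ℂ (spectralSub val op S') := by
  have := h.finiteDimensional hS
  have := h.finiteDimensional hS'
  have h1 : spectralSub val op (S ∪ S') = spectralSub val op S ⊔ spectralSub val op S' :=
    iSup_union
  rw [h1]
  exact Submodule.finrank_add_le_finrank_add_finrank _ _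

/-- If two operators with compact resolvent differ by a bounded perturbation on a subspace of
codimension at most `m`, then the numbers of their eigenvalues in concentric intervals compare. -/
theorem HasCompactResolvent.finrank_le {Y' : Type*} [AddCommGroup Y'] [Module ℂ Y']
    {val' op' : Y' →ₗ[ℂ] H} {T' : H →L[ℂ] H} {μ' : ℝ}
    (h : HasCompactResolvent val op T μ) (h' : HasCompactResolvent val' op' T' μ')
    {m : ℕ} (b : Y →ₗ[ℂ] (Fin m → ℂ)) {v : ℝ}
    (hb : ∀ y, b y = 0 → ∃ y', val' y' = val y ∧ ‖op' y' - op y‖ ≤ v * ‖val y‖)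
    {c r r' : ℝ} (hr : 0 ≤ r) (hr' : 0 ≤ r') (hlt : r + v < r') :
    Module.finrank ℂ (spectralSub val op (Set.Icc (c - r) (c + r))) ≤
      m + Module.finrank ℂ (spectralSub val' op' (Set.Icc (c - r') (c + r'))) := by
  set W := spectralSub val op (Set.Icc (c - r) (c + r))
  set W' := spectralSub val' op' (Set.Icc (c - r') (c + r'))
  have : FiniteDimensional ℂ W := h.finiteDimensional (Metric.isBounded_Icc _ _)
  have : FiniteDimensional ℂ W' := h'.finiteDimensional (Metric.isBounded_Icc _ _)
  set M' := W'.map val'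
  have hM' : Module.finrank ℂ M' = Module.finrank ℂ W' :=
    (W'.equivMapOfInjective val' h'.injective).finrank_eq.symm
  have : FiniteDimensional ℂ M' := inferInstanceAs (FiniteDimensional ℂ (W'.map val'))
  by_contra! hgt
  -- The `m` conditions and the projection onto the second spectral subspace together have a target
  -- of dimension smaller than that of `W`. A nonzero kernel vector `w` would satisfy `r' ‖w‖ ≤
  -- ‖(op' - c) w‖ ≤ (v + r) ‖w‖`, which is impossible.
  let Φ : W →ₗ[ℂ] (Fin m → ℂ) × M' :=
    (b.comp W.subtype).prod ((M'.orthogonalProjectionOnto : H →ₗ[ℂ] M').comp (val.comp W.subtype))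
  have hker : LinearMap.ker Φ ≠ ⊥ := by
    refine LinearMap.ker_ne_bot_of_finrank_lt ?_
    rw [Module.finrank_prod, Module.finrank_fin_fun, hM']
    exact hgt
  obtain ⟨w, hw, hw0⟩ := (Submodule.ne_bot_iff _).1 hker
  have hw1 : b w = 0 := congrArg Prod.fst (LinearMap.mem_ker.1 hw)
  have hw2 : M'.orthogonalProjectionOnto (val w) = 0 := congrArg Prod.snd (LinearMap.mem_ker.1 hw)
  obtain ⟨y', hy', hy'v⟩ := hb w hw1
  have hperp : ∀ u ∈ W', inner ℂ (val' y') (val' u) = 0 := by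
    intro u hu
    rw [hy']
    have h1 := Submodule.starProjection_inner_eq_zero (K := M') (val w) (val' u)
      (Submodule.mem_map_of_mem hu)
    have h2 : M'.starProjection (val w) = 0 := by
      rw [Submodule.starProjection_apply, hw2]; rfl
    rwa [h2, sub_zero] at h1
  have h1 := h'.le_norm_sub hr' hperp
  have h2 := h.norm_sub_le hr w.2
  rw [hy'] at h1
  have h3 : ‖op' y' - (c : ℂ) • val w‖ ≤ ‖op' y' - op w‖ + ‖op w - (c : ℂ) • val w‖ :=
    norm_sub_le_norm_sub_add_norm_sub _ _ _
  have h4 : 0 < ‖val (w : Y)‖ := by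
    rw [norm_pos_iff]
    intro h0
    apply hw0
    have : (w : Y) = 0 := h.injective (by rw [h0, map_zero])
    exact Subtype.ext this
  nlinarith

end Resolvent

/-! ### Linear second order equations -/

/-- Truncation of a real number to `[-R, R]`. -/
def truncate (R x : ℝ) : ℝ := max (-R) (min R x)

theorem abs_truncate_sub_le (R x y : ℝ) : |truncate R x - truncate R y| ≤ |x - y| := by
  unfold truncate
  have h1 := abs_max_sub_max_le_max (-R) (min R x) (-R) (min R y)
  have h2 := abs_min_sub_min_le_max R x R y
  simp only [sub_self, abs_zero] at h1 h2
  rw [max_eq_right (a := (0 : ℝ)) (abs_nonneg _)] at h1 h2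
  exact h1.trans h2

theorem truncate_of_abs_le {R x : ℝ} (h : |x| ≤ R) : truncate R x = x := by
  rw [abs_le] at h
  rw [truncate, min_eq_right h.2, max_eq_right h.1]

theorem abs_truncate_le_self {R : ℝ} (hR : 0 ≤ R) (x : ℝ) : |truncate R x| ≤ |x| := by
  have h := abs_truncate_sub_le R x 0
  rwa [truncate_of_abs_le (x := 0) (by simpa using hR), sub_zero, sub_zero] at h

theorem abs_truncate_le {R : ℝ} (hR : 0 ≤ R) (x : ℝ) : |truncate R x| ≤ R :=
  abs_le.2 ⟨le_max_left _ _, max_le (by linarith) (min_le_left _ _)⟩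

/-- Picard–Lindelöf is applied to the truncated system, whose right-hand side is globally bounded
and Lipschitz, so one application covers all of `[0, B]`. Grönwall's inequality bounds the solution
by `R = ‖y₀‖ exp (q B)`, so the truncation is never active. Taking `q ≥ 1` lets one constant serve
both components. -/
theorem exists_solution_linear_ode {B : ℝ} (hB : 0 ≤ B) {Q : ℝ → ℝ}
    (hQ : ContinuousOn Q (Set.Icc 0 B)) (α₀ β₀ : ℝ) :
    ∃ u u' : ℝ → ℝ, u 0 = α₀ ∧ u' 0 = β₀ ∧ ∀ x ∈ Set.Icc 0 B,
      HasDerivWithinAt u (u' x) (Set.Icc 0 B) x ∧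
      HasDerivWithinAt u' (Q x * u x) (Set.Icc 0 B) x := by
  obtain ⟨q₀, hq₀⟩ := isCompact_Icc.exists_bound_of_continuousOn hQ
  set q : ℝ := max 1 q₀
  have hq1 : 1 ≤ q := le_max_left _ _
  have hq0 : 0 ≤ q := by linarith
  have hq : ∀ x ∈ Set.Icc 0 B, |Q x| ≤ q := fun x hx => (hq₀ x hx).trans (le_max_right _ _)
  set y₀ : ℝ × ℝ := (α₀, β₀)
  set R : ℝ := ‖y₀‖ * Real.exp (q * B)
  have hR : 0 ≤ R := by positivity
  set f : ℝ → ℝ × ℝ → ℝ × ℝ := fun t y => (truncate R y.2, Q t * truncate R y.1)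
  have hPL : IsPicardLindelof f (tmin := 0) (tmax := B) ⟨0, le_rfl, hB⟩ y₀
      (Real.toNNReal (q * R * B)) 0 (Real.toNNReal (q * R)) (Real.toNNReal q) := by
    refine ⟨fun t ht => ?_, fun y _ => ?_, fun t ht y _ => ?_, ?_⟩
    · refine LipschitzOnWith.of_dist_le_mul fun y _ z _ => ?_
      rw [Real.coe_toNNReal _ hq0, dist_eq_norm, dist_eq_norm]
      have h1 : |y.1 - z.1| ≤ ‖y - z‖ := norm_fst_le (y - z)
      have h2 : |y.2 - z.2| ≤ ‖y - z‖ := norm_snd_le (y - z)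
      have h3 := norm_nonneg (y - z)
      refine max_le ?_ ?_
      · calc ‖truncate R y.2 - truncate R z.2‖ ≤ |y.2 - z.2| := abs_truncate_sub_le _ _ _
          _ ≤ 1 * ‖y - z‖ := by linarith
          _ ≤ q * ‖y - z‖ := by gcongr
      · change ‖Q t * truncate R y.1 - Q t * truncate R z.1‖ ≤ _
        rw [← mul_sub, norm_mul]
        have h4 := (abs_truncate_sub_le R y.1 z.1).trans h1
        exact mul_le_mul (hq t ht) h4 (abs_nonneg _) hq0
    · exact continuousOn_const.prodMk (hQ.mul continuousOn_const)
    · rw [Real.coe_toNNReal _ (by positivity)]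
      refine max_le ?_ ?_
      · calc ‖truncate R y.2‖ ≤ R := abs_truncate_le hR _
          _ ≤ q * R := le_mul_of_one_le_left hR hq1
      · change ‖Q t * truncate R y.1‖ ≤ _
        rw [norm_mul]
        exact mul_le_mul (hq t ht) (abs_truncate_le hR _) (abs_nonneg _) hq0
    · rw [Real.coe_toNNReal _ (by positivity), Real.coe_toNNReal _ (by positivity)]
      simp [hB]
  obtain ⟨y, hy0, hy⟩ := hPL.exists_eq_forall_mem_Icc_hasDerivWithinAt₀
  have hbound : ∀ x ∈ Set.Icc 0 B, ‖y x‖ ≤ R := by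
    intro x hx
    have h := norm_le_gronwallBound_of_norm_deriv_right_le (f := y) (f' := fun t => f t (y t))
      (δ := ‖y₀‖) (K := q) (ε := 0) (fun t ht => (hy t ht).continuousWithinAt)
      (fun t ht => (hy t (Set.Ico_subset_Icc_self ht)).mono_of_mem_nhdsWithin
        (Icc_mem_nhdsGE_of_mem ht)) (by rw [show y 0 = y₀ from hy0]) ?_ x hx
    · rw [gronwallBound_ε0, sub_zero] at h
      refine h.trans ?_
      exact mul_le_mul_of_nonneg_left
        (Real.exp_le_exp.2 (mul_le_mul_of_nonneg_left hx.2 hq0)) (norm_nonneg _)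
    · intro t ht
      have ht' := Set.Ico_subset_Icc_self ht
      rw [add_zero]
      refine max_le ?_ ?_
      · calc ‖truncate R (y t).2‖ ≤ |(y t).2| := abs_truncate_le_self hR _
          _ ≤ 1 * ‖y t‖ := by rw [one_mul]; exact norm_snd_le (y t)
          _ ≤ q * ‖y t‖ := by gcongr
      · change ‖Q t * truncate R (y t).1‖ ≤ _
        rw [norm_mul]
        exact mul_le_mul (hq t ht') ((abs_truncate_le_self hR _).trans (norm_fst_le (y t)))
          (abs_nonneg _) hq0
  refine ⟨fun x => (y x).1, fun x => (y x).2, congrArg Prod.fst hy0,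
    congrArg Prod.snd hy0, fun x hx => ?_⟩
  have h1 : truncate R (y x).1 = (y x).1 :=
    truncate_of_abs_le ((norm_fst_le (y x)).trans (hbound x hx))
  have h2 : truncate R (y x).2 = (y x).2 :=
    truncate_of_abs_le ((norm_snd_le (y x)).trans (hbound x hx))
  have h3 := hy x hx
  simp only [f, h1, h2] at h3
  exact ⟨(hasFDerivAt_fst (𝕜 := ℝ) (p := y x)).comp_hasDerivWithinAt x h3,
    (hasFDerivAt_snd (𝕜 := ℝ) (p := y x)).comp_hasDerivWithinAt x h3⟩

/-! ### Compact operators into continuous functions -/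

section CompactKernel

variable {α H : Type*} [TopologicalSpace α] [CompactSpace α] [NormedAddCommGroup H]
  [InnerProductSpace ℂ H]

/-- The operator `h ↦ (x ↦ ⟪κ x, h⟫)` with values in continuous functions. -/
def kernelOp (κ : C(α, H)) : H →L[ℂ] C(α, ℂ) :=
  LinearMap.mkContinuous
    { toFun := fun h => ⟨fun x => inner ℂ (κ x) h, by fun_prop⟩
      map_add' := fun h k => by ext x; simp
      map_smul' := fun c h => by ext x; simp } ‖κ‖ fun h => by
    rw [ContinuousMap.norm_le _ (by positivity)]
    intro x
    exact (norm_inner_le_norm _ _).trans (by gcongr; exact κ.norm_coe_le_norm x)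

@[simp]
theorem kernelOp_apply (κ : C(α, H)) (h : H) (x : α) : kernelOp κ h x = inner ℂ (κ x) h := rfl

/-- By Cauchy–Schwarz the image of the unit ball is bounded by `‖κ‖` and has the common modulus of
continuity `‖κ x₀ - κ x‖`, so Arzelà–Ascoli applies. -/
theorem isCompactOperator_kernelOp (κ : C(α, H)) : IsCompactOperator (kernelOp κ) := by
  refine (isCompactOperator_iff_isCompact_closure_image_closedBall
    (kernelOp κ : H →ₗ[ℂ] C(α, ℂ)) one_pos).2 ?_
  set e := ContinuousMap.isometryEquivBoundedOfCompact α ℂ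
  set A : Set (BoundedContinuousFunction α ℂ) :=
    e '' ((kernelOp κ : H →ₗ[ℂ] C(α, ℂ)) '' Metric.closedBall 0 1)
  have hmem : ∀ f ∈ A, ∃ h : H, ‖h‖ ≤ 1 ∧ ∀ x, f x = inner ℂ (κ x) h := by
    rintro _ ⟨_, ⟨h, hh, rfl⟩, rfl⟩
    exact ⟨h, by simpa using hh, fun x => rfl⟩
  have hA : IsCompact (closure A) := by
    refine BoundedContinuousFunction.arzela_ascoli (Metric.closedBall 0 ‖κ‖)
      (isCompact_closedBall _ _) A ?_ ?_
    · intro f x hf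
      obtain ⟨h, hh, hf⟩ := hmem f hf
      rw [hf, mem_closedBall_zero_iff]
      calc ‖inner ℂ (κ x) h‖ ≤ ‖κ x‖ * ‖h‖ := norm_inner_le_norm _ _
        _ ≤ ‖κ‖ * 1 := by gcongr; exact κ.norm_coe_le_norm x
        _ = ‖κ‖ := mul_one _
    · intro x₀
      refine Metric.equicontinuousAt_of_continuity_modulus (fun x => ‖κ x₀ - κ x‖) ?_ _ ?_
      · have : Continuous fun x => ‖κ x₀ - κ x‖ := by fun_prop
        simpa using this.tendsto x₀
      · refine Eventually.of_forall fun x f => ?_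
        obtain ⟨h, hh, hf⟩ := hmem f f.2
        change dist ((f : BoundedContinuousFunction α ℂ) x₀)
          ((f : BoundedContinuousFunction α ℂ) x) ≤ _
        rw [hf, hf, dist_eq_norm, ← inner_sub_left]
        calc ‖inner ℂ (κ x₀ - κ x) h‖ ≤ ‖κ x₀ - κ x‖ * ‖h‖ := norm_inner_le_norm _ _
          _ ≤ ‖κ x₀ - κ x‖ * 1 := by gcongr
          _ = _ := mul_one _
  have h2 := hA.image e.symm.continuous
  have h3 : e.symm '' closure A = closure ((kernelOp κ : H →ₗ[ℂ] C(α, ℂ)) '' Metric.closedBall 0 1) := by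
    rw [show (e.symm '' closure A) = closure (e.symm '' A) from
      e.symm.toHomeomorph.image_closure A]
    congr 1
    simp only [A, Set.image_image, e.symm_apply_apply]
  rwa [h3] at h2

end CompactKernel

/-! ### Schrödinger operators on an interval -/

/-- Continuous complex functions on `[0, B]`. -/
abbrev IccFun (B : ℝ) := C(Set.Icc (0 : ℝ) B, ℂ)

/-- Lebesgue measure on `[0, B]`. -/
abbrev iccMeasure (B : ℝ) : Measure (Set.Icc (0 : ℝ) B) := Measure.comap Subtype.val volume

/-- The space `L²(0, B)`. -/
abbrev IccL2 (B : ℝ) := Lp ℂ 2 (iccMeasure B)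

instance (B : ℝ) : IsFiniteMeasure (iccMeasure B) := by
  refine ⟨?_⟩
  rw [comap_subtype_coe_apply measurableSet_Icc, Subtype.coe_image_univ, Real.volume_Icc]
  exact ENNReal.ofReal_lt_top

theorem isOpenPosMeasure_iccMeasure {B : ℝ} (hB : 0 < B) : (iccMeasure B).IsOpenPosMeasure := by
  refine ⟨fun U hU hne => ?_⟩
  rw [comap_subtype_coe_apply measurableSet_Icc]
  obtain ⟨O, hO, rfl⟩ := isOpen_induced_iff.1 hU
  obtain ⟨x, hx⟩ := hne
  rw [Subtype.image_preimage_coe]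
  have h1 : (O ∩ Set.Ioo 0 B).Nonempty := by
    have : (x : ℝ) ∈ closure (Set.Ioo 0 B) := by rw [closure_Ioo hB.ne]; exact x.2
    exact mem_closure_iff.1 this O hO hx
  have h2 := (hO.inter isOpen_Ioo).measure_pos volume h1
  refine (h2.trans_le (measure_mono ?_)).ne'
  rintro y ⟨hy, hy'⟩
  exact ⟨Set.Ioo_subset_Icc_self hy', hy⟩

/-- The embedding of continuous functions into `L²`. -/
def toL2 (B : ℝ) : IccFun B →L[ℂ] IccL2 B := ContinuousMap.toLp 2 (iccMeasure B) ℂ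

/-- Extension by zero of a function on `[0, B]`. -/
def zext {B : ℝ} : IccFun B →ₗ[ℂ] (ℝ → ℂ) where
  toFun f x := open Classical in if h : x ∈ Set.Icc 0 B then f ⟨x, h⟩ else 0
  map_add' f g := by
    ext x
    by_cases h : x ∈ Set.Icc 0 B
    · simp only [Pi.add_apply, ContinuousMap.add_apply, dif_pos h]
    · simp only [Pi.add_apply, dif_neg h, add_zero]
  map_smul' c f := by
    ext x
    by_cases h : x ∈ Set.Icc 0 B
    · simp only [Pi.smul_apply, ContinuousMap.smul_apply, dif_pos h, RingHom.id_apply]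
    · simp only [Pi.smul_apply, dif_neg h, smul_zero]

theorem zext_of_mem {B : ℝ} (f : IccFun B) {x : ℝ} (h : x ∈ Set.Icc 0 B) :
    zext f x = f ⟨x, h⟩ := by
  simp only [zext, LinearMap.coe_mk, AddHom.coe_mk, dif_pos h]

theorem zext_of_notMem {B : ℝ} (f : IccFun B) {x : ℝ} (h : x ∉ Set.Icc 0 B) :
    zext f x = 0 := by simp only [zext, LinearMap.coe_mk, AddHom.coe_mk, dif_neg h]

@[simp]
theorem zext_coe {B : ℝ} (f : IccFun B) (x : Set.Icc 0 B) : zext f x = f x := zext_of_mem f x.2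

theorem zext_injective {B : ℝ} : Function.Injective (zext (B := B)) := fun f g h => by
  ext x; rw [← zext_coe, ← zext_coe, h]

theorem continuousOn_zext {B : ℝ} (f : IccFun B) : ContinuousOn (zext f) (Set.Icc 0 B) := by
  rw [continuousOn_iff_continuous_domRestrict]
  have : (Set.Icc 0 B).domRestrict (zext f) = f := by ext x; exact zext_coe f x
  rw [this]; exact f.continuous

/-- The restriction to `[0, B]` of a continuous function. -/
def iccRestrict {B : ℝ} (f : ℝ → ℂ) (hf : ContinuousOn f (Set.Icc 0 B)) : IccFun B :=
  ⟨(Set.Icc 0 B).domRestrict f, continuousOn_iff_continuous_domRestrict.1 hf⟩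

theorem zext_iccRestrict {B : ℝ} (f : ℝ → ℂ) (hf : ContinuousOn f (Set.Icc 0 B)) {x : ℝ}
    (hx : x ∈ Set.Icc 0 B) : zext (iccRestrict f hf) x = f x := by
  rw [zext_of_mem _ hx]; rfl

theorem integral_iccMeasure {B : ℝ} (hB : 0 ≤ B) (F : ℝ → ℂ) :
    ∫ x, F (x : Set.Icc 0 B) ∂(iccMeasure B) = ∫ x in (0 : ℝ)..B, F x := by
  rw [integral_subtype_comap measurableSet_Icc F, integral_Icc_eq_integral_Ioc,
    intervalIntegral.integral_of_le hB]

theorem inner_toL2 {B : ℝ} (hB : 0 ≤ B) (f g : IccFun B) :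
    inner ℂ (toL2 B f) (toL2 B g) =
      ∫ x in (0 : ℝ)..B, zext g x * (starRingEnd ℂ) (zext f x) := by
  rw [toL2, ContinuousMap.inner_toLp, ← integral_iccMeasure hB]
  simp only [zext_coe]

/-- The first derivative and the boundary conditions for a triple `(f, f', f'')`. -/
def schrodingerDom (B : ℝ) (M N : Matrix (Fin 2) (Fin 2) ℂ) :
    Submodule ℂ (IccFun B × IccFun B × IccFun B) where
  carrier := {z | (∀ x ∈ Set.Icc 0 B,
      HasDerivWithinAt (zext z.1) (zext z.2.1 x) (Set.Icc 0 B) x ∧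
      HasDerivWithinAt (zext z.2.1) (zext z.2.2 x) (Set.Icc 0 B) x) ∧
    M.mulVec ![zext z.1 0, zext z.2.1 0] + N.mulVec ![zext z.1 B, zext z.2.1 B] = 0}
  zero_mem' := by
    refine ⟨fun x _ => ?_, ?_⟩
    · simp only [Prod.fst_zero, Prod.snd_zero, map_zero]
      exact ⟨hasDerivWithinAt_const _ _ _, hasDerivWithinAt_const _ _ _⟩
    · simp
  add_mem' := by
    rintro z z' ⟨h1, h2⟩ ⟨h3, h4⟩
    refine ⟨fun x hx => ?_, ?_⟩
    · simp only [Prod.fst_add, Prod.snd_add, map_add]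
      exact ⟨(h1 x hx).1.add (h3 x hx).1, (h1 x hx).2.add (h3 x hx).2⟩
    · have e : ∀ s t s' t' : ℂ, (![s + s', t + t'] : Fin 2 → ℂ) = ![s, t] + ![s', t'] := by
        intros; simp
      simp only [Prod.fst_add, Prod.snd_add, map_add, Pi.add_apply]
      rw [e, e, Matrix.mulVec_add, Matrix.mulVec_add, add_add_add_comm, h2, h4, add_zero]
  smul_mem' := by
    rintro c z ⟨h1, h2⟩
    refine ⟨fun x hx => ?_, ?_⟩
    · simp only [Prod.smul_fst, Prod.smul_snd, map_smul]
      exact ⟨(h1 x hx).1.const_smul c, (h1 x hx).2.const_smul c⟩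
    · have e : ∀ s t : ℂ, (![c * s, c * t] : Fin 2 → ℂ) = c • ![s, t] := by
        intros; simp
      simp only [Prod.smul_fst, Prod.smul_snd, map_smul, Pi.smul_apply, smul_eq_mul]
      rw [e, e, Matrix.mulVec_smul, Matrix.mulVec_smul, ← smul_add, h2, smul_zero]

/-- The inclusion of the domain into `L²`. -/
def schrodingerVal (B : ℝ) (M N : Matrix (Fin 2) (Fin 2) ℂ) :
    schrodingerDom B M N →ₗ[ℂ] IccL2 B :=
  (toL2 B : IccFun B →ₗ[ℂ] IccL2 B) ∘ₗ LinearMap.fst ℂ _ _ ∘ₗ (schrodingerDom B M N).subtype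

/-- The operator `f ↦ -f'' + V f`. -/
def schrodingerOp {B : ℝ} (V : IccFun B) (M N : Matrix (Fin 2) (Fin 2) ℂ) :
    schrodingerDom B M N →ₗ[ℂ] IccL2 B :=
  (toL2 B : IccFun B →ₗ[ℂ] IccL2 B) ∘ₗ (LinearMap.mulLeft ℂ V ∘ₗ LinearMap.fst ℂ _ _ -
    LinearMap.snd ℂ _ _ ∘ₗ LinearMap.snd ℂ _ _) ∘ₗ (schrodingerDom B M N).subtype

theorem schrodingerVal_apply {B : ℝ} {M N : Matrix (Fin 2) (Fin 2) ℂ} (z : schrodingerDom B M N) :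
    schrodingerVal B M N z = toL2 B z.1.1 := rfl

theorem schrodingerOp_apply {B : ℝ} (V : IccFun B) {M N : Matrix (Fin 2) (Fin 2) ℂ}
    (z : schrodingerDom B M N) :
    schrodingerOp V M N z = toL2 B (V * z.1.1 - z.1.2.2) := rfl

theorem toL2_injective {B : ℝ} (hB : 0 < B) : Function.Injective (toL2 B) :=
  haveI := isOpenPosMeasure_iccMeasure hB
  ContinuousMap.toLp_injective (iccMeasure B)

theorem hasDerivWithinAt_Icc_unique {B : ℝ} (hB : 0 < B) {f : ℝ → ℂ} {x : ℝ} {a b : ℂ}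
    (hx : x ∈ Set.Icc 0 B) (h1 : HasDerivWithinAt f a (Set.Icc 0 B) x)
    (h2 : HasDerivWithinAt f b (Set.Icc 0 B) x) : a = b := by
  rw [← h1.derivWithin (uniqueDiffOn_Icc hB x hx), h2.derivWithin (uniqueDiffOn_Icc hB x hx)]

theorem schrodingerDom_ext {B : ℝ} (hB : 0 < B) {M N : Matrix (Fin 2) (Fin 2) ℂ}
    {z z' : schrodingerDom B M N} (h : z.1.1 = z'.1.1) : z = z' := by
  have h1 : z.1.2.1 = z'.1.2.1 := by
    ext x
    have e1 := (z.2.1 x x.2).1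
    rw [h] at e1
    simpa using hasDerivWithinAt_Icc_unique hB x.2 e1 (z'.2.1 x x.2).1
  have h2 : z.1.2.2 = z'.1.2.2 := by
    ext x
    have e1 := (z.2.1 x x.2).2
    rw [h1] at e1
    simpa using hasDerivWithinAt_Icc_unique hB x.2 e1 (z'.2.1 x x.2).2
  exact Subtype.ext (Prod.ext h (Prod.ext h1 h2))

theorem schrodingerVal_injective {B : ℝ} (hB : 0 < B) (M N : Matrix (Fin 2) (Fin 2) ℂ) :
    Function.Injective (schrodingerVal B M N) := fun _ _ h =>
  schrodingerDom_ext hB (toL2_injective hB h)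

/-- Boundary conditions for which the boundary form of two admissible functions takes the same
value at both ends. -/
def IsotropicBC (M N : Matrix (Fin 2) (Fin 2) ℂ) : Prop :=
  ∀ a b a' b' : Fin 2 → ℂ, M.mulVec a + N.mulVec b = 0 → M.mulVec a' + N.mulVec b' = 0 →
    star (a 0) * a' 1 - star (a 1) * a' 0 = star (b 0) * b' 1 - star (b 1) * b' 0

/-- Green's identity. -/
theorem inner_schrodingerOp {B : ℝ} (hB : 0 < B) {V : IccFun B}
    (hV : ∀ x, (starRingEnd ℂ) (V x) = V x) {M N : Matrix (Fin 2) (Fin 2) ℂ}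
    (hMN : IsotropicBC M N) (z z' : schrodingerDom B M N) :
    inner ℂ (schrodingerVal B M N z) (schrodingerOp V M N z') =
      inner ℂ (schrodingerOp V M N z) (schrodingerVal B M N z') := by
  rw [schrodingerVal_apply, schrodingerVal_apply, schrodingerOp_apply, schrodingerOp_apply]
  obtain ⟨⟨f, f1, f2⟩, hz, hzb⟩ := z
  obtain ⟨⟨k, k1, k2⟩, hz', hzb'⟩ := z'
  have hbc := hMN _ _ _ _ hzb hzb'
  simp only at hz hz' hbc ⊢
  have hco : ∀ f : IccFun B, IntervalIntegrable (zext f) volume 0 B := fun f => by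
    refine ContinuousOn.intervalIntegrable ?_
    rw [Set.uIcc_of_le hB.le]; exact continuousOn_zext f
  have hfun : ∀ (g h : IccFun B), (fun x => zext g x * (starRingEnd ℂ) (zext h x)) =
      zext (g * star h) := by
    intro g h
    funext x
    by_cases hx : x ∈ Set.Icc 0 B
    · rw [zext_of_mem _ hx, zext_of_mem _ hx, zext_of_mem _ hx]; rfl
    · rw [zext_of_notMem _ hx, zext_of_notMem _ hx, zext_of_notMem _ hx, zero_mul]
  -- The real potential cancels in the difference of the two inner products. What remains is the
  -- integral of the derivative of `k' f̄ - k f̄'`, whose boundary values agree by isotropy.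
  have hFTC := intervalIntegral.integral_eq_sub_of_hasDerivAt_of_le (a := 0) (b := B) (E := ℂ) hB.le
    (f := fun x => zext k1 x * (starRingEnd ℂ) (zext f x) - zext k x * (starRingEnd ℂ) (zext f1 x))
    (f' := fun x => zext k2 x * (starRingEnd ℂ) (zext f x) -
      zext k x * (starRingEnd ℂ) (zext f2 x)) ?_ ?_ ?_
  · have h0 : (0 : ℝ) ∈ Set.Icc 0 B := ⟨le_rfl, hB.le⟩
    simp only [Matrix.cons_val_zero, Matrix.cons_val_one] at hbc
    rw [inner_toL2 hB.le, inner_toL2 hB.le, ← sub_eq_zero, ← intervalIntegral.integral_sub]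
    · have : ∀ x ∈ Set.uIcc 0 B, zext (V * k - k2) x * (starRingEnd ℂ) (zext f x) -
          zext k x * (starRingEnd ℂ) (zext (V * f - f2) x) =
          - (zext k2 x * (starRingEnd ℂ) (zext f x) - zext k x * (starRingEnd ℂ) (zext f2 x)) := by
        intro x hx
        rw [Set.uIcc_of_le hB.le] at hx
        simp only [zext_of_mem _ hx, ContinuousMap.sub_apply, ContinuousMap.mul_apply, map_sub,
          map_mul, hV]
        ring
      rw [intervalIntegral.integral_congr this, intervalIntegral.integral_neg, hFTC, neg_eq_zero]
      simp only [Complex.star_def] at hbc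
      linear_combination (-1 : ℂ) * hbc
    · rw [hfun]; exact hco _
    · rw [hfun]; exact hco _
  · have h1 : ∀ g h : IccFun B, ContinuousOn (fun x => zext g x * (starRingEnd ℂ) (zext h x))
        (Set.Icc 0 B) := fun g h => by rw [hfun]; exact continuousOn_zext _
    exact (h1 k1 f).sub (h1 k f1)
  · intro x hx
    have hx' := Set.Ioo_subset_Icc_self hx
    have hn : Set.Icc 0 B ∈ 𝓝 x := Icc_mem_nhds hx.1 hx.2
    have d1 := (hz x hx').1.hasDerivAt hn
    have d2 := (hz x hx').2.hasDerivAt hn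
    have d3 := (hz' x hx').1.hasDerivAt hn
    have d4 := (hz' x hx').2.hasDerivAt hn
    refine ((d4.mul d1.star).sub (d3.mul d2.star)).congr_deriv ?_
    simp only [Complex.star_def]
    ring
  · have h1 : ∀ g h : IccFun B, IntervalIntegrable (fun x => zext g x * (starRingEnd ℂ) (zext h x))
        volume 0 B := fun g h => by rw [hfun]; exact hco _
    exact (h1 k2 f).sub (h1 k f2)

/-- Some real number is not an eigenvalue. -/
theorem exists_eigSub_schrodinger_eq_bot {B : ℝ} (hB : 0 < B) {V : IccFun B}
    (hV : ∀ x, (starRingEnd ℂ) (V x) = V x) {M N : Matrix (Fin 2) (Fin 2) ℂ}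
    (hMN : IsotropicBC M N) :
    ∃ μ : ℝ, eigSub (Y := schrodingerDom B M N) (H := IccL2 B) (schrodingerVal B M N) (schrodingerOp V M N) μ = ⊥ := by
  by_contra! hne
  have hex : ∀ μ : ℝ, ∃ e : IccL2 B, ‖e‖ = 1 ∧ ∃ y, schrodingerVal B M N y = e ∧
      schrodingerOp V M N y = (μ : ℂ) • e := by
    intro μ
    obtain ⟨y, hy, hy0⟩ := (Submodule.ne_bot_iff _).1 (hne μ)
    rw [mem_eigSub] at hy
    have h0 : schrodingerVal B M N y ≠ 0 := fun h =>
      hy0 (schrodingerVal_injective hB M N (by rw [h, map_zero]))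
    refine ⟨((‖schrodingerVal B M N y‖ : ℂ)⁻¹) • schrodingerVal B M N y, ?_,
      ((‖schrodingerVal B M N y‖ : ℂ)⁻¹) • y, map_smul _ _ _, ?_⟩
    · rw [norm_smul, norm_inv, Complex.norm_real, norm_norm, inv_mul_cancel₀ (norm_ne_zero_iff.2 h0)]
    · rw [map_smul, hy, smul_comm]
  choose e he y hy hy' using hex
  have horth : Pairwise fun i j => inner ℂ (e i) (e j) = 0 := by
    intro i j hij
    have h := inner_schrodingerOp hB hV hMN (y i) (y j)
    rw [hy, hy, hy', hy', inner_smul_left, inner_smul_right, Complex.conj_ofReal] at h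
    have h2 : ((j : ℂ) - i) * inner ℂ (e i) (e j) = 0 := by linear_combination h
    refine (mul_eq_zero.1 h2).resolve_left (sub_ne_zero.2 ?_)
    exact_mod_cast hij.symm
  have hsep : Pairwise fun i j => 1 ≤ dist (e i) (e j) := by
    intro i j hij
    have h := norm_sub_sq (𝕜 := ℂ) (e i) (e j)
    rw [horth hij, he, he] at h
    norm_num at h
    rw [dist_eq_norm]
    nlinarith [norm_nonneg (e i - e j)]
  -- If every real number were an eigenvalue, the orthonormal eigenvectors would give uncountably
  -- many disjoint balls in the separable space `L²`.
  have hdisj : Pairwise fun i j => Disjoint (Metric.ball (e i) (1 / 2)) (Metric.ball (e j) (1 / 2)) :=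
    fun i j hij => Metric.ball_disjoint_ball (by linarith [hsep hij])
  have : Fact ((2 : ENNReal) ≠ ⊤) := ⟨ENNReal.ofNat_ne_top⟩
  have hc := hdisj.countable_of_isOpen_disjoint (fun i => Metric.isOpen_ball)
    fun i => Metric.nonempty_ball.2 (by norm_num)
  exact not_countable (α := ℝ) hc

theorem hasDerivWithinAt_integral_Icc {E : Type*} [NormedAddCommGroup E] [NormedSpace ℝ E]
    [CompleteSpace E] {a b : ℝ} {f : ℝ → E} (hf : ContinuousOn f (Set.Icc a b)) {x : ℝ}
    (hx : x ∈ Set.Icc a b) :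
    HasDerivWithinAt (fun y => ∫ t in a..y, f t) (f x) (Set.Icc a b) x := by
  have hab : a ≤ b := hx.1.trans hx.2
  have : Fact (x ∈ Set.Icc a b) := ⟨hx⟩
  refine intervalIntegral.integral_hasDerivWithinAt_right ?_ (s := Set.Icc a b)
    (t := Set.Icc a b) ?_ (hf x hx)
  · refine (hf.mono ?_).intervalIntegrable
    rw [Set.uIcc_of_le hx.1]
    exact Set.Icc_subset_Icc_right hx.2
  · exact hf.stronglyMeasurableAtFilter_nhdsWithin measurableSet_Icc x

theorem exists_mem_schrodingerDom {B : ℝ} {M N : Matrix (Fin 2) (Fin 2) ℂ}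
    {f f1 f2 : ℝ → ℂ}
    (h : ∀ x ∈ Set.Icc 0 B, HasDerivWithinAt f (f1 x) (Set.Icc 0 B) x)
    (h' : ∀ x ∈ Set.Icc 0 B, HasDerivWithinAt f1 (f2 x) (Set.Icc 0 B) x)
    (hc : ContinuousOn f2 (Set.Icc 0 B)) (hB : 0 ≤ B)
    (hbc : M.mulVec ![f 0, f1 0] + N.mulVec ![f B, f1 B] = 0) :
    ∃ z : schrodingerDom B M N, ∀ x : Set.Icc 0 B,
      z.1.1 x = f x ∧ z.1.2.1 x = f1 x ∧ z.1.2.2 x = f2 x := by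
  have c0 : ContinuousOn f (Set.Icc 0 B) := fun x hx => (h x hx).continuousWithinAt
  have c1 : ContinuousOn f1 (Set.Icc 0 B) := fun x hx => (h' x hx).continuousWithinAt
  have h0 : (0 : ℝ) ∈ Set.Icc 0 B := ⟨le_rfl, hB⟩
  have hB' : B ∈ Set.Icc 0 B := ⟨hB, le_rfl⟩
  refine ⟨⟨(iccRestrict f c0, iccRestrict f1 c1, iccRestrict f2 hc), fun x hx => ⟨?_, ?_⟩, ?_⟩,
    fun x => ⟨rfl, rfl, rfl⟩⟩
  · rw [zext_iccRestrict f1 c1 hx]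
    exact (h x hx).congr (fun y hy => zext_iccRestrict f c0 hy) (zext_iccRestrict f c0 hx)
  · rw [zext_iccRestrict f2 hc hx]
    exact (h' x hx).congr (fun y hy => zext_iccRestrict f1 c1 hy) (zext_iccRestrict f1 c1 hx)
  · simp only [zext_iccRestrict f c0 h0, zext_iccRestrict f c0 hB', zext_iccRestrict f1 c1 h0,
      zext_iccRestrict f1 c1 hB']
    exact hbc

theorem eq_of_hasDerivWithinAt_Icc_zero {B : ℝ} {g : ℝ → ℂ}
    (h : ∀ y ∈ Set.Icc 0 B, HasDerivWithinAt g 0 (Set.Icc 0 B) y) {x : ℝ}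
    (hx : x ∈ Set.Icc 0 B) : g x = g 0 :=
  constant_of_has_deriv_right_zero (fun y hy => (h y hy).continuousWithinAt)
    (fun y hy => (h y (Set.Ico_subset_Icc_self hy)).mono_of_mem_nhdsWithin
      (Icc_mem_nhdsGE_of_mem hy)) x hx

/-- A fundamental system of solutions of `u'' = Q u` on `[0, B]`, with values in `ℂ`. -/
structure FundamentalSystem (B : ℝ) (Q u₁ u₁' u₂ u₂' : ℝ → ℂ) : Prop where
  deriv₁ : ∀ x ∈ Set.Icc 0 B, HasDerivWithinAt u₁ (u₁' x) (Set.Icc 0 B) x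
  deriv₁' : ∀ x ∈ Set.Icc 0 B, HasDerivWithinAt u₁' (Q x * u₁ x) (Set.Icc 0 B) x
  deriv₂ : ∀ x ∈ Set.Icc 0 B, HasDerivWithinAt u₂ (u₂' x) (Set.Icc 0 B) x
  deriv₂' : ∀ x ∈ Set.Icc 0 B, HasDerivWithinAt u₂' (Q x * u₂ x) (Set.Icc 0 B) x
  init₁ : u₁ 0 = 1
  init₁' : u₁' 0 = 0
  init₂ : u₂ 0 = 0
  init₂' : u₂' 0 = 1

theorem exists_fundamentalSystem {B : ℝ} (hB : 0 ≤ B) {Q : ℝ → ℝ}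
    (hQ : ContinuousOn Q (Set.Icc 0 B)) :
    ∃ u₁ u₁' u₂ u₂', FundamentalSystem B (fun x => (Q x : ℂ)) u₁ u₁' u₂ u₂' := by
  obtain ⟨u, u', h0, h0', h⟩ := exists_solution_linear_ode hB hQ 1 0
  obtain ⟨k, k', k0, k0', hk⟩ := exists_solution_linear_ode hB hQ 0 1
  refine ⟨fun x => u x, fun x => u' x, fun x => k x, fun x => k' x,
    fun x hx => (h x hx).1.ofReal_comp, fun x hx => ?_, fun x hx => (hk x hx).1.ofReal_comp,
    fun x hx => ?_, by simp [h0], by simp [h0'], by simp [k0], by simp [k0']⟩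
  · simpa using (h x hx).2.ofReal_comp
  · simpa using (hk x hx).2.ofReal_comp

/-! ### Variation of constants and Green's function -/

namespace FundamentalSystem

variable {B : ℝ} {Q u₁ u₁' u₂ u₂' : ℝ → ℂ}

theorem wronskian (h : FundamentalSystem B Q u₁ u₁' u₂ u₂') {x : ℝ} (hx : x ∈ Set.Icc 0 B) :
    u₁ x * u₂' x - u₁' x * u₂ x = 1 := by
  have hd : ∀ y ∈ Set.Icc 0 B, HasDerivWithinAt (fun y => u₁ y * u₂' y - u₁' y * u₂ y) 0
      (Set.Icc 0 B) y := by
    intro y hy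
    refine (((h.deriv₁ y hy).mul (h.deriv₂' y hy)).sub
      ((h.deriv₁' y hy).mul (h.deriv₂ y hy))).congr_deriv ?_
    ring
  have hc := eq_of_hasDerivWithinAt_Icc_zero hd hx
  rw [hc, h.init₁, h.init₁', h.init₂, h.init₂']
  ring

/-- General solution of `-f'' + Q f = g` with `f(0) = α` and `f'(0) = β`. The terms from
differentiating the integrals cancel in `f'`, and in `f''` they combine to `-g` times the Wronskian,
which is `1`. -/
theorem hasDerivWithinAt_variation (h : FundamentalSystem B Q u₁ u₁' u₂ u₂') {g : ℝ → ℂ}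
    (hg : ContinuousOn g (Set.Icc 0 B)) (α β : ℂ) {x : ℝ} (hx : x ∈ Set.Icc 0 B) :
    HasDerivWithinAt (fun x => u₁ x * (∫ t in (0 : ℝ)..x, u₂ t * g t) -
        u₂ x * (∫ t in (0 : ℝ)..x, u₁ t * g t) + α * u₁ x + β * u₂ x)
      (u₁' x * (∫ t in (0 : ℝ)..x, u₂ t * g t) -
        u₂' x * (∫ t in (0 : ℝ)..x, u₁ t * g t) + α * u₁' x + β * u₂' x) (Set.Icc 0 B) x ∧
    HasDerivWithinAt (fun x => u₁' x * (∫ t in (0 : ℝ)..x, u₂ t * g t) -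
        u₂' x * (∫ t in (0 : ℝ)..x, u₁ t * g t) + α * u₁' x + β * u₂' x)
      (Q x * (u₁ x * (∫ t in (0 : ℝ)..x, u₂ t * g t) -
        u₂ x * (∫ t in (0 : ℝ)..x, u₁ t * g t) + α * u₁ x + β * u₂ x) - g x) (Set.Icc 0 B) x := by
  have c₁ : ContinuousOn u₁ (Set.Icc 0 B) := fun y hy => (h.deriv₁ y hy).continuousWithinAt
  have c₂ : ContinuousOn u₂ (Set.Icc 0 B) := fun y hy => (h.deriv₂ y hy).continuousWithinAt
  have i₁ := hasDerivWithinAt_integral_Icc (c₁.mul hg) hx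
  have i₂ := hasDerivWithinAt_integral_Icc (c₂.mul hg) hx
  have hw := h.wronskian hx
  constructor
  · refine (((((h.deriv₁ x hx).mul i₂).sub ((h.deriv₂ x hx).mul i₁)).add
      ((h.deriv₁ x hx).const_mul α)).add ((h.deriv₂ x hx).const_mul β)).congr_deriv ?_
    simp only [Pi.mul_apply]
    ring
  · refine (((((h.deriv₁' x hx).mul i₂).sub ((h.deriv₂' x hx).mul i₁)).add
      ((h.deriv₁' x hx).const_mul α)).add ((h.deriv₂' x hx).const_mul β)).congr_deriv ?_
    simp only [Pi.mul_apply]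
    linear_combination (-g x) * hw

/-- Green's function built from a fundamental system. -/
def green (u₁ u₂ : ℝ → ℂ) (C : Matrix (Fin 2) (Fin 2) ℂ) (x s : ℝ) : ℂ :=
  u₁ x * u₂ (min x s) - u₂ x * u₁ (min x s) + u₁ x * (C 0 0 * u₂ s - C 0 1 * u₁ s) +
    u₂ x * (C 1 0 * u₂ s - C 1 1 * u₁ s)

/-- The `min x s` in the kernel replaces a case distinction: for `s ≥ x` the first two terms cancel,
and for `s ≤ x` they give the causal kernel. Joint continuity is then immediate. -/
theorem continuous_green (h : FundamentalSystem B Q u₁ u₁' u₂ u₂')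
    (C : Matrix (Fin 2) (Fin 2) ℂ) :
    Continuous fun p : Set.Icc 0 B × Set.Icc 0 B => green u₁ u₂ C p.1 p.2 := by
  have c₁ : ContinuousOn u₁ (Set.Icc 0 B) := fun y hy => (h.deriv₁ y hy).continuousWithinAt
  have c₂ : ContinuousOn u₂ (Set.Icc 0 B) := fun y hy => (h.deriv₂ y hy).continuousWithinAt
  have a₁ : Continuous fun p : Set.Icc 0 B × Set.Icc 0 B => (p.1 : ℝ) := by fun_prop
  have a₂ : Continuous fun p : Set.Icc 0 B × Set.Icc 0 B => (p.2 : ℝ) := by fun_prop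
  have b₁ := c₁.comp_continuous a₁ fun p => p.1.2
  have b₂ := c₂.comp_continuous a₁ fun p => p.1.2
  have d₁ := c₁.comp_continuous a₂ fun p => p.2.2
  have d₂ := c₂.comp_continuous a₂ fun p => p.2.2
  have hm : ∀ p : Set.Icc 0 B × Set.Icc 0 B, min (p.1 : ℝ) p.2 ∈ Set.Icc 0 B := fun p =>
    ⟨le_min p.1.2.1 p.2.2.1, (min_le_left _ _).trans p.1.2.2⟩
  have e₁ := c₁.comp_continuous (a₁.min a₂) hm
  have e₂ := c₂.comp_continuous (a₁.min a₂) hm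
  exact (((b₁.mul e₂).sub (b₂.mul e₁)).add
    (b₁.mul ((d₂.const_mul (C 0 0)).sub (d₁.const_mul (C 0 1))))).add
    (b₂.mul ((d₂.const_mul (C 1 0)).sub (d₁.const_mul (C 1 1))))

theorem integral_green (h : FundamentalSystem B Q u₁ u₁' u₂ u₂') (C : Matrix (Fin 2) (Fin 2) ℂ)
    {g : ℝ → ℂ} (hg : ContinuousOn g (Set.Icc 0 B)) {x : ℝ} (hx : x ∈ Set.Icc 0 B) :
    ∫ s in (0 : ℝ)..B, green u₁ u₂ C x s * g s =
      u₁ x * (∫ t in (0 : ℝ)..x, u₂ t * g t) - u₂ x * (∫ t in (0 : ℝ)..x, u₁ t * g t) +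
      (C 0 0 * (∫ t in (0 : ℝ)..B, u₂ t * g t) - C 0 1 * (∫ t in (0 : ℝ)..B, u₁ t * g t)) * u₁ x +
      (C 1 0 * (∫ t in (0 : ℝ)..B, u₂ t * g t) - C 1 1 * (∫ t in (0 : ℝ)..B, u₁ t * g t)) * u₂ x := by
  have hB : 0 ≤ B := hx.1.trans hx.2
  have c₁ : ContinuousOn u₁ (Set.Icc 0 B) := fun y hy => (h.deriv₁ y hy).continuousWithinAt
  have c₂ : ContinuousOn u₂ (Set.Icc 0 B) := fun y hy => (h.deriv₂ y hy).continuousWithinAt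
  have I₁ : ∀ y ∈ Set.Icc 0 B, IntervalIntegrable (fun t => u₁ t * g t) volume 0 y := fun y hy => by
    refine ((c₁.mul hg).mono ?_).intervalIntegrable
    rw [Set.uIcc_of_le hy.1]; exact Set.Icc_subset_Icc_right hy.2
  have I₂ : ∀ y ∈ Set.Icc 0 B, IntervalIntegrable (fun t => u₂ t * g t) volume 0 y := fun y hy => by
    refine ((c₂.mul hg).mono ?_).intervalIntegrable
    rw [Set.uIcc_of_le hy.1]; exact Set.Icc_subset_Icc_right hy.2
  have hBm : B ∈ Set.Icc 0 B := ⟨hB, le_rfl⟩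
  set A : ℝ → ℂ := fun s => u₁ x * (u₂ (min x s) * g s) - u₂ x * (u₁ (min x s) * g s)
  set D : ℝ → ℂ := fun s => u₁ x * (C 0 0 * (u₂ s * g s) - C 0 1 * (u₁ s * g s)) +
        u₂ x * (C 1 0 * (u₂ s * g s) - C 1 1 * (u₁ s * g s))
  have hAD : (fun s => green u₁ u₂ C x s * g s) = fun s => A s + D s := by
    funext s; simp only [green, A, D]; ring
  have hA1 : Set.EqOn A (fun s => u₁ x * (u₂ s * g s) - u₂ x * (u₁ s * g s)) (Set.uIcc 0 x) := by
    intro s hs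
    rw [Set.uIcc_of_le hx.1] at hs
    simp only [A, min_eq_right hs.2]
  have hA2 : Set.EqOn A (fun _ => 0) (Set.uIcc x B) := by
    intro s hs
    rw [Set.uIcc_of_le hx.2] at hs
    simp only [A, min_eq_left hs.1]
    ring
  have hi1 : IntervalIntegrable A volume 0 x :=
    (((I₂ x hx).const_mul _).sub ((I₁ x hx).const_mul _)).congr
      (fun s hs => (hA1 (Set.uIoc_subset_uIcc hs)).symm)
  have hi2 : IntervalIntegrable A volume x B :=
    (intervalIntegrable_const (c := (0 : ℂ))).congr
      (fun s hs => (hA2 (Set.uIoc_subset_uIcc hs)).symm)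
  have hD1 : IntervalIntegrable (fun s => u₁ x * (C 0 0 * (u₂ s * g s) - C 0 1 * (u₁ s * g s)))
      volume 0 B := (((I₂ B hBm).const_mul _).sub ((I₁ B hBm).const_mul _)).const_mul _
  have hD2 : IntervalIntegrable (fun s => u₂ x * (C 1 0 * (u₂ s * g s) - C 1 1 * (u₁ s * g s)))
      volume 0 B := (((I₂ B hBm).const_mul _).sub ((I₁ B hBm).const_mul _)).const_mul _
  rw [hAD, intervalIntegral.integral_add (hi1.trans hi2) (hD1.add hD2),
    ← intervalIntegral.integral_add_adjacent_intervals hi1 hi2,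
    intervalIntegral.integral_congr hA1, intervalIntegral.integral_congr hA2,
    intervalIntegral.integral_sub ((I₂ x hx).const_mul _) ((I₁ x hx).const_mul _),
    intervalIntegral.integral_const_mul, intervalIntegral.integral_const_mul,
    intervalIntegral.integral_zero, intervalIntegral.integral_add hD1 hD2,
    intervalIntegral.integral_const_mul, intervalIntegral.integral_const_mul,
    intervalIntegral.integral_sub ((I₂ B hBm).const_mul _) ((I₁ B hBm).const_mul _),
    intervalIntegral.integral_sub ((I₂ B hBm).const_mul _) ((I₁ B hBm).const_mul _)]
  simp only [intervalIntegral.integral_const_mul]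
  ring

/-- Green's function as a family of elements of `L²`. -/
def greenKernel (h : FundamentalSystem B Q u₁ u₁' u₂ u₂') (C : Matrix (Fin 2) (Fin 2) ℂ) :
    C(Set.Icc 0 B, IccL2 B) :=
  (⟨toL2 B, (toL2 B).continuous⟩ : C(IccFun B, IccL2 B)).comp
    (ContinuousMap.curry (star ⟨_, h.continuous_green C⟩))

/-- The conjugate in `greenKernel` undoes the conjugation in the first argument of the inner
product. -/
theorem kernelOp_greenKernel (h : FundamentalSystem B Q u₁ u₁' u₂ u₂')
    (C : Matrix (Fin 2) (Fin 2) ℂ) (g : IccFun B) (x : Set.Icc 0 B) :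
    kernelOp (h.greenKernel C) (toL2 B g) x =
      ∫ s in (0 : ℝ)..B, green u₁ u₂ C x s * zext g s := by
  have hB : 0 ≤ B := x.2.1.trans x.2.2
  rw [kernelOp_apply]
  change inner ℂ (toL2 B (ContinuousMap.curry
    (star (⟨_, h.continuous_green C⟩ : C(Set.Icc 0 B × Set.Icc 0 B, ℂ))) x)) (toL2 B g) = _
  rw [inner_toL2 hB]
  refine intervalIntegral.integral_congr fun s hs => ?_
  rw [Set.uIcc_of_le hB] at hs
  simp only [zext_of_mem _ hs]
  change g _ * (starRingEnd ℂ) (star (green u₁ u₂ C x s)) = _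
  rw [Complex.star_def, Complex.conj_conj, mul_comm]

end FundamentalSystem

/-- A Schrödinger operator with isotropic boundary conditions has compact self-adjoint
resolvent. -/
theorem exists_hasCompactResolvent {B : ℝ} (hB : 0 < B) {V : ℝ → ℝ}
    (hV : ContinuousOn V (Set.Icc 0 B)) {Vc : IccFun B} (hVc : ∀ x, Vc x = (V x : ℂ))
    {M N : Matrix (Fin 2) (Fin 2) ℂ} (hMN : IsotropicBC M N) :
    ∃ (T : IccL2 B →L[ℂ] IccL2 B) (μ : ℝ),
      HasCompactResolvent (Y := schrodingerDom B M N) (H := IccL2 B)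
        (schrodingerVal B M N) (schrodingerOp Vc M N) T μ := by
  have hVr : ∀ x, (starRingEnd ℂ) (Vc x) = Vc x := fun x => by rw [hVc, Complex.conj_ofReal]
  obtain ⟨μ, hμ⟩ := exists_eigSub_schrodinger_eq_bot hB hVr hMN
  obtain ⟨u₁, u₁', u₂, u₂', h⟩ := exists_fundamentalSystem (Q := fun x => V x - μ) hB.le
    (hV.sub continuousOn_const)
  have h0 : (0 : ℝ) ∈ Set.Icc 0 B := ⟨le_rfl, hB.le⟩
  have hBm : B ∈ Set.Icc 0 B := ⟨hB.le, le_rfl⟩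
  have hQc : ContinuousOn (fun x => ((V x - μ : ℝ) : ℂ)) (Set.Icc 0 B) :=
    Complex.continuous_ofReal.comp_continuousOn (hV.sub continuousOn_const)
  set Φ : Matrix (Fin 2) (Fin 2) ℂ := !![u₁ B, u₂ B; u₁' B, u₂' B]
  -- Since `Φ` carries the data `(f, f')` of a homogeneous solution from `0` to `B`, the matrix `D`
  -- expresses the boundary conditions for `α u₁ + β u₂` in terms of `(α, β)`.
  set D := M + N * Φ
  have key : ∀ (g : ℝ → ℂ), ContinuousOn g (Set.Icc 0 B) → ∀ α β : ℂ,
      (D.mulVec ![α, β] + (N * Φ).mulVec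
        ![∫ t in (0 : ℝ)..B, u₂ t * g t, -∫ t in (0 : ℝ)..B, u₁ t * g t] = 0) →
      ∃ z : schrodingerDom B M N, ∀ x : Set.Icc 0 B,
        z.1.1 x = u₁ x * (∫ t in (0 : ℝ)..x, u₂ t * g t) -
          u₂ x * (∫ t in (0 : ℝ)..x, u₁ t * g t) + α * u₁ x + β * u₂ x ∧
        z.1.2.1 x = u₁' x * (∫ t in (0 : ℝ)..x, u₂ t * g t) -
          u₂' x * (∫ t in (0 : ℝ)..x, u₁ t * g t) + α * u₁' x + β * u₂' x ∧
        Vc x * z.1.1 x - z.1.2.2 x - μ * z.1.1 x = g x := by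
    intro g hg α β hbc
    have hd := fun x (hx : x ∈ Set.Icc 0 B) => h.hasDerivWithinAt_variation hg α β hx
    obtain ⟨z, hz⟩ := exists_mem_schrodingerDom (M := M) (N := N) (fun x hx => (hd x hx).1)
      (fun x hx => (hd x hx).2)
      ((hQc.mul fun x hx => (hd x hx).1.continuousWithinAt).sub hg) hB.le (by
        rw [← hbc]
        simp only [intervalIntegral.integral_same, h.init₁, h.init₁', h.init₂, h.init₂', D,
          Matrix.add_mulVec, ← Matrix.mulVec_mulVec, add_assoc, ← Matrix.mulVec_add]
        have e1 : ![1 * 0 - 0 * 0 + (α * 1 + β * 0), 0 * 0 - 1 * 0 + (α * 0 + β * 1)] = ![α, β] := by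
          funext i; fin_cases i <;> simp
        rw [e1]
        congr 2
        funext i; fin_cases i <;> simp [Φ] <;> ring)
    refine ⟨z, fun x => ⟨(hz x).1, (hz x).2.1, ?_⟩⟩
    rw [(hz x).2.2, ← (hz x).1, hVc]
    push_cast
    ring
  -- A kernel vector of `D` would be the initial data of an eigenfunction for `μ`, which is
  -- excluded.
  have hD : IsUnit D.det := by
    rw [isUnit_iff_ne_zero]
    intro hdet
    obtain ⟨v, hv0, hv⟩ := Matrix.exists_mulVec_eq_zero_iff.2 hdet
    obtain ⟨z, hz⟩ := key (fun _ => 0) continuousOn_const (v 0) (v 1) (by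
      have : ![v 0, v 1] = v := by funext i; fin_cases i <;> rfl
      rw [this, hv]
      simp)
    have hz0 : z ∈ eigSub (Y := schrodingerDom B M N) (H := IccL2 B)
        (schrodingerVal B M N) (schrodingerOp Vc M N) μ := by
      rw [mem_eigSub, schrodingerOp_apply, schrodingerVal_apply, ← map_smul]
      congr 1
      ext x
      have := (hz x).2.2
      simp only [ContinuousMap.sub_apply, ContinuousMap.mul_apply, ContinuousMap.smul_apply,
        smul_eq_mul]
      linear_combination this
    rw [hμ, Submodule.mem_bot] at hz0
    apply hv0
    have e1 := (hz ⟨0, h0⟩).1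
    have e2 := (hz ⟨0, h0⟩).2.1
    rw [hz0] at e1 e2
    simp only [mul_zero, intervalIntegral.integral_zero, h.init₁, h.init₁', h.init₂, h.init₂',
      Submodule.coe_zero, Prod.fst_zero, Prod.snd_zero, ContinuousMap.zero_apply] at e1 e2
    funext i
    fin_cases i
    · simpa using e1.symm
    · simpa using e2.symm
  -- With `(α, β) = C w`, where `w = (∫ u₂ g, -∫ u₁ g)`, the boundary equation `D (α, β) + N Φ w =
  -- 0` holds. The solution that satisfies the boundary conditions is then the integral of `green u₁
  -- u₂ C` against `g`.
  set C := -(D⁻¹ * (N * Φ))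
  set S : IccL2 B →L[ℂ] IccFun B := kernelOp (h.greenKernel C)
  set T : IccL2 B →L[ℂ] IccL2 B := (toL2 B).comp S
  have hS : ∀ g : IccFun B, ∃ z : schrodingerDom B M N, z.1.1 = S (toL2 B g) ∧
      schrodingerOp Vc M N z - (μ : ℂ) • schrodingerVal B M N z = toL2 B g := by
    intro g
    obtain ⟨z, hz⟩ := key (zext g) (continuousOn_zext g)
      (C 0 0 * (∫ t in (0 : ℝ)..B, u₂ t * zext g t) - C 0 1 * (∫ t in (0 : ℝ)..B, u₁ t * zext g t))
      (C 1 0 * (∫ t in (0 : ℝ)..B, u₂ t * zext g t) - C 1 1 * (∫ t in (0 : ℝ)..B, u₁ t * zext g t))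
      (by
        set w : Fin 2 → ℂ :=
          ![∫ t in (0 : ℝ)..B, u₂ t * zext g t, -∫ t in (0 : ℝ)..B, u₁ t * zext g t] with hw
        have : ![C 0 0 * (∫ t in (0 : ℝ)..B, u₂ t * zext g t) -
            C 0 1 * (∫ t in (0 : ℝ)..B, u₁ t * zext g t),
            C 1 0 * (∫ t in (0 : ℝ)..B, u₂ t * zext g t) -
            C 1 1 * (∫ t in (0 : ℝ)..B, u₁ t * zext g t)] = C.mulVec w := by
          funext i
          fin_cases i <;> simp [Matrix.mulVec, dotProduct, Fin.sum_univ_two, hw] <;> ring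
        rw [this, Matrix.mulVec_mulVec]
        have hDC : D * C = -(N * Φ) := by
          simp only [C]
          rw [mul_neg, ← mul_assoc, Matrix.mul_nonsing_inv _ hD, one_mul]
        rw [hDC, Matrix.neg_mulVec, neg_add_cancel])
    refine ⟨z, ?_, ?_⟩
    · ext x
      rw [(hz x).1, h.kernelOp_greenKernel, h.integral_green C (continuousOn_zext g) x.2]
    · rw [schrodingerOp_apply, schrodingerVal_apply, ← map_smul, ← map_sub]
      congr 1
      ext x
      have := (hz x).2.2
      rw [zext_coe] at this
      simpa using this
  refine ⟨T, μ, schrodingerVal_injective hB M N,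
    (isCompactOperator_kernelOp _).clm_comp (toL2 B), ?_, ?_, ?_⟩
  -- Symmetry is needed only for continuous functions, which are dense. There `T` produces elements
  -- of the domain and Green's identity applies.
  · have hdense : DenseRange (toL2 B) :=
      ContinuousMap.toLp_denseRange ℂ (iccMeasure B) ℂ ENNReal.ofNat_ne_top
    intro x y
    refine hdense.induction_on₂ (p := fun x y => inner ℂ (T x) y = inner ℂ x (T y)) ?_ ?_ x y
    · exact isClosed_eq (by fun_prop) (by fun_prop)
    · intro f g
      obtain ⟨z, hz, hz'⟩ := hS f
      obtain ⟨k, hk, hk'⟩ := hS g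
      have e1 : T (toL2 B f) = schrodingerVal B M N z := by
        rw [schrodingerVal_apply, hz]; rfl
      have e2 : T (toL2 B g) = schrodingerVal B M N k := by
        rw [schrodingerVal_apply, hk]; rfl
      rw [e1, e2, ← hz', ← hk', inner_sub_left, inner_sub_right, inner_schrodingerOp hB hVr hMN,
        inner_smul_left, inner_smul_right, Complex.conj_ofReal]
  · intro y
    obtain ⟨z, hz, hz'⟩ := hS ((Vc * y.1.1 - y.1.2.2) - (μ : ℂ) • y.1.1)
    have e1 : schrodingerOp Vc M N y - (μ : ℂ) • schrodingerVal B M N y =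
        toL2 B ((Vc * y.1.1 - y.1.2.2) - (μ : ℂ) • y.1.1) := by
      rw [map_sub, map_smul]; rfl
    have e2 : T (toL2 B ((Vc * y.1.1 - y.1.2.2) - (μ : ℂ) • y.1.1)) = schrodingerVal B M N z := by
      rw [schrodingerVal_apply, hz]; rfl
    rw [e1, e2]
    exact congrArg _ (eq_of_eigSub_eq_bot hμ (hz'.trans e1.symm))
  -- An eigenvector for `ν ≠ 0` has the continuous representative `ν⁻¹ • S g`, so the equation can
  -- be solved classically with it as right-hand side.
  · intro g ν hν hg
    have e1 : toL2 B (ν⁻¹ • S g) = g := by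
      rw [map_smul]
      change ν⁻¹ • T g = g
      rw [hg, smul_smul, inv_mul_cancel₀ hν, one_smul]
    obtain ⟨z, hz, hz'⟩ := hS (ν⁻¹ • S g)
    rw [e1] at hz hz'
    have e2 : schrodingerVal B M N z = ν • g := by
      rw [schrodingerVal_apply, hz, ← hg]; rfl
    refine ⟨ν⁻¹ • z, ?_, ?_⟩
    · rw [map_smul, e2, smul_smul, inv_mul_cancel₀ hν, one_smul]
    · rw [map_smul, sub_eq_iff_eq_add.1 hz', e2, smul_add, smul_smul, smul_smul, ← add_smul]
      congr 1
      field_simp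
      ring

/-! ### Comparison with the Dirichlet Laplacian -/

/-- The Sturm–Liouville problem of a Schrödinger operator on `[0, B]`. -/
abbrev schrodingerProblem (B : ℝ) (V : ℝ → ℝ) (M N : Matrix (Fin 2) (Fin 2) ℂ) :
    SturmLiouville where
  a := 0
  b := B
  p := fun _ => 1
  q := V
  w := fun _ => 1
  bcL := M
  bcR := N

/-- The eigenspace inside the domain of a Schrödinger operator. -/
abbrev schrodingerEig {B : ℝ} (V : IccFun B) (M N : Matrix (Fin 2) (Fin 2) ℂ) (s : ℝ) :
    Submodule ℂ (schrodingerDom B M N) :=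
  eigSub (Y := schrodingerDom B M N) (H := IccL2 B) (schrodingerVal B M N) (schrodingerOp V M N) s

/-- The spectral subspace inside the domain of a Schrödinger operator. -/
abbrev schrodingerSpectralSub {B : ℝ} (V : IccFun B) (M N : Matrix (Fin 2) (Fin 2) ℂ)
    (S : Set ℝ) : Submodule ℂ (schrodingerDom B M N) :=
  spectralSub (Y := schrodingerDom B M N) (H := IccL2 B) (schrodingerVal B M N)
    (schrodingerOp V M N) S

theorem mem_schrodingerEig {B : ℝ} (hB : 0 < B) {V : IccFun B} {M N : Matrix (Fin 2) (Fin 2) ℂ}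
    {s : ℝ} {z : schrodingerDom B M N} :
    z ∈ schrodingerEig V M N s ↔ ∀ x, z.1.2.2 x = (V x - s) * z.1.1 x := by
  rw [mem_eigSub, schrodingerOp_apply, schrodingerVal_apply, ← map_smul]
  constructor
  · intro h x
    have := congrArg (fun f : IccFun B => f x) (toL2_injective hB h)
    simp only [ContinuousMap.sub_apply, ContinuousMap.mul_apply, ContinuousMap.smul_apply,
      smul_eq_mul] at this
    linear_combination -this
  · intro h
    congr 1
    ext x
    simp only [ContinuousMap.sub_apply, ContinuousMap.mul_apply, ContinuousMap.smul_apply,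
      smul_eq_mul, h]
    ring

/-- Solutions are only required to be differentiable with differentiable quasi-derivative, but the
equation `u'' = (V - s) u` makes `u''` continuous, so each one defines a triple in `schrodingerDom`.
-/
theorem finrank_eigenspace_schrodingerProblem {B : ℝ} (hB : 0 < B) {V : ℝ → ℝ}
    (hV : ContinuousOn V (Set.Icc 0 B)) {Vc : IccFun B} (hVc : ∀ x, Vc x = (V x : ℂ))
    (M N : Matrix (Fin 2) (Fin 2) ℂ) (s : ℝ) :
    Module.finrank ℂ ((schrodingerProblem B V M N).eigenspace s) =
      Module.finrank ℂ (schrodingerEig Vc M N s) := by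
  set P := schrodingerProblem B V M N
  have hdom : P.dom = Set.Icc 0 B := rfl
  let φ : schrodingerEig Vc M N s →ₗ[ℂ] (ℝ → ℂ) :=
    zext ∘ₗ LinearMap.fst ℂ _ _ ∘ₗ (schrodingerDom B M N).subtype ∘ₗ Submodule.subtype _
  have hφ : ∀ z, φ z = zext z.1.1.1 := fun z => rfl
  have hinj : Function.Injective φ := fun z z' h =>
    Subtype.ext (schrodingerDom_ext hB (zext_injective h))
  have hrange : LinearMap.range φ = P.eigenspace s := by
    ext u
    constructor
    · rintro ⟨⟨z, hz⟩, rfl⟩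
      rw [hφ]
      rw [mem_schrodingerEig hB] at hz
      have hq : P.quasiDeriv (zext z.1.1) = zext z.1.2.1 := by
        funext x
        by_cases hx : x ∈ Set.Icc 0 B
        · simp only [SturmLiouville.quasiDeriv, hdom]
          rw [(z.2.1 x hx).1.derivWithin (uniqueDiffOn_Icc hB x hx)]
          change ((1 : ℝ) : ℂ) * _ = _
          rw [Complex.ofReal_one, one_mul]
        · have hx' : x ∉ closure P.dom := by rwa [hdom, isClosed_Icc.closure_eq]
          rw [SturmLiouville.quasiDeriv, derivWithin_zero_of_notMem_closure hx', mul_zero,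
            zext_of_notMem _ hx]
      refine ⟨fun x hx => zext_of_notMem _ hx,
        fun x hx => (z.2.1 x hx).1.differentiableWithinAt, ?_, ?_, ?_⟩
      · rw [hq]
        exact fun x hx => (z.2.1 x hx).2.differentiableWithinAt
      · rw [SturmLiouville.SatisfiesBC, hq]
        exact z.2.2
      · intro x hx
        rw [SturmLiouville.expr, hq, hdom, (z.2.1 x hx).2.derivWithin (uniqueDiffOn_Icc hB x hx),
          zext_of_mem _ hx, zext_of_mem _ hx, hz, hVc, show P.w x = 1 from rfl,
          show P.q x = V x from rfl]
        push_cast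
        ring
    · intro hu
      have hq : ∀ x ∈ Set.Icc 0 B, P.quasiDeriv u x = derivWithin u (Set.Icc 0 B) x := by
        intro x _
        simp [SturmLiouville.quasiDeriv, hdom, P]
      have h1 : ∀ x ∈ Set.Icc 0 B,
          HasDerivWithinAt u (P.quasiDeriv u x) (Set.Icc 0 B) x := by
        intro x hx
        rw [hq x hx]
        exact (hu.diff x hx).hasDerivWithinAt
      have h2 : ∀ x ∈ Set.Icc 0 B,
          HasDerivWithinAt (P.quasiDeriv u) ((V x - s) * u x) (Set.Icc 0 B) x := by
        intro x hx
        have h3 := hu.eqn x hx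
        have h4 := (hu.diff_quasi x hx).hasDerivWithinAt
        rw [SturmLiouville.expr] at h3
        refine h4.congr_deriv ?_
        simp only [P, Complex.ofReal_one, div_one, one_mul] at h3 ⊢
        linear_combination -h3
      have hc : ContinuousOn (fun x => ((V x : ℂ) - s) * u x) (Set.Icc 0 B) :=
        ((Complex.continuous_ofReal.comp_continuousOn hV).sub continuousOn_const).mul
          fun x hx => (h1 x hx).continuousWithinAt
      obtain ⟨z, hz⟩ := exists_mem_schrodingerDom (M := M) (N := N) h1 h2 hc hB.le hu.bc
      refine ⟨⟨z, (mem_schrodingerEig hB).2 fun x => ?_⟩, ?_⟩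
      · rw [(hz x).2.2, (hz x).1, hVc]
      · rw [hφ]
        funext x
        by_cases hx : x ∈ Set.Icc 0 B
        · rw [zext_of_mem _ hx, (hz ⟨x, hx⟩).1]
        · rw [zext_of_notMem _ hx, hu.zero_outside x hx]
  rw [← hrange, LinearMap.finrank_range_of_inj hinj]

/-- The boundary values of an element of the domain. -/
def boundaryValues (B : ℝ) (M N : Matrix (Fin 2) (Fin 2) ℂ) :
    schrodingerDom B M N →ₗ[ℂ] (Fin 4 → ℂ) where
  toFun z := ![zext z.1.1 0, zext z.1.2.1 0, zext z.1.1 B, zext z.1.2.1 B]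
  map_add' z z' := by funext i; fin_cases i <;> simp
  map_smul' c z := by funext i; fin_cases i <;> simp

theorem norm_toL2_mul_le {B : ℝ} (g f : IccFun B) {v : ℝ} (h : ∀ x, ‖g x‖ ≤ v) :
    ‖toL2 B (g * f)‖ ≤ v * ‖toL2 B f‖ := by
  refine Lp.norm_le_mul_norm_of_ae_le_mul ?_
  filter_upwards [ContinuousMap.coeFn_toLp (p := 2) (iccMeasure B) (𝕜 := ℂ) (g * f),
    ContinuousMap.coeFn_toLp (p := 2) (iccMeasure B) (𝕜 := ℂ) f] with x h1 h2
  change ‖(ContinuousMap.toLp 2 (iccMeasure B) ℂ (g * f)) x‖ ≤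
    v * ‖(ContinuousMap.toLp 2 (iccMeasure B) ℂ f) x‖
  rw [h1, h2, ContinuousMap.mul_apply, norm_mul]
  gcongr
  exact h x

/-- A function whose four boundary values vanish satisfies every boundary condition, so the same
triple lies in both domains and only the potentials differ. This is the origin of the constant `4`.
-/
theorem finrank_schrodingerSpectralSub_le {B : ℝ} {V V' : IccFun B}
    {M N M' N' : Matrix (Fin 2) (Fin 2) ℂ} {T T' : IccL2 B →L[ℂ] IccL2 B} {μ μ' : ℝ}
    (h : HasCompactResolvent (Y := schrodingerDom B M N) (H := IccL2 B)
        (schrodingerVal B M N) (schrodingerOp V M N) T μ)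
    (h' : HasCompactResolvent (Y := schrodingerDom B M' N') (H := IccL2 B)
        (schrodingerVal B M' N') (schrodingerOp V' M' N') T' μ')
    {v : ℝ} (hv : ∀ x, ‖V' x - V x‖ ≤ v)
    {c r r' : ℝ} (hr : 0 ≤ r) (hr' : 0 ≤ r') (hlt : r + v < r') :
    Module.finrank ℂ (schrodingerSpectralSub V M N (Set.Icc (c - r) (c + r))) ≤
      4 + Module.finrank ℂ (schrodingerSpectralSub V' M' N' (Set.Icc (c - r') (c + r'))) := by
  refine h.finrank_le h' (boundaryValues B M N) (v := v) (fun z hz => ?_) hr hr' hlt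
  have h0 : zext z.1.1 0 = 0 := congrFun hz 0
  have h1 : zext z.1.2.1 0 = 0 := congrFun hz 1
  have h2 : zext z.1.1 B = 0 := congrFun hz 2
  have h3 : zext z.1.2.1 B = 0 := congrFun hz 3
  have e0 : (![0, 0] : Fin 2 → ℂ) = 0 := by funext i; fin_cases i <;> rfl
  refine ⟨⟨z.1, z.2.1, ?_⟩, rfl, ?_⟩
  · rw [h0, h1, h2, h3, e0, Matrix.mulVec_zero, Matrix.mulVec_zero, add_zero]
  · rw [schrodingerOp_apply, schrodingerOp_apply, schrodingerVal_apply, ← map_sub]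
    have : V' * z.1.1 - z.1.2.2 - (V * z.1.1 - z.1.2.2) = (V' - V) * z.1.1 := by ring
    rw [this]
    exact norm_toL2_mul_le _ _ hv

/-- The left Dirichlet condition. -/
abbrev dirichletL : Matrix (Fin 2) (Fin 2) ℂ := !![1, 0; 0, 0]

/-- The right Dirichlet condition. -/
abbrev dirichletR : Matrix (Fin 2) (Fin 2) ℂ := !![0, 0; 1, 0]

theorem dirichlet_iff (a b : Fin 2 → ℂ) :
    dirichletL.mulVec a + dirichletR.mulVec b = 0 ↔ a 0 = 0 ∧ b 0 = 0 := by
  constructor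
  · intro h
    have h0 := congrFun h 0
    have h1 := congrFun h 1
    simp [dotProduct] at h0 h1
    exact ⟨h0, h1⟩
  · rintro ⟨h0, h1⟩
    funext i
    fin_cases i <;> simp [dotProduct, h0, h1]

theorem isotropicBC_dirichlet : IsotropicBC dirichletL dirichletR := by
  intro a b a' b' h h'
  rw [dirichlet_iff] at h h'
  simp [h.1, h.2, h'.1, h'.2]

/-! ### The explicit spectrum of the Dirichlet Laplacian -/

section Dirichlet

variable {B : ℝ} {s : ℝ}

/-- The quantities `f' cos + ζ f sin` and `f' sin - ζ f cos` are constant in `x`; solving for `f'`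
and `ζ f` uses `sin² + cos² = 1`. A complex square root `ζ` of `s` treats all signs of `s` at once.
-/
theorem dirichlet_eigenfunction (hB : 0 < B) {z : schrodingerDom B dirichletL dirichletR}
    (hz : z ∈ schrodingerEig (0 : IccFun B) dirichletL dirichletR s) {ζ : ℂ} (hζ : ζ ^ 2 = s)
    {x : ℝ} (hx : x ∈ Set.Icc 0 B) :
    zext z.1.2.1 x = zext z.1.2.1 0 * Complex.cos (ζ * x) ∧
      ζ * zext z.1.1 x = zext z.1.2.1 0 * Complex.sin (ζ * x) := by
  rw [mem_schrodingerEig hB] at hz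
  obtain ⟨h0, -⟩ := (dirichlet_iff _ _).1 z.2.2
  simp only [Matrix.cons_val_zero] at h0
  have hcos : ∀ y : ℝ, HasDerivWithinAt (fun y : ℝ => Complex.cos (ζ * y))
      (-Complex.sin (ζ * y) * ζ) (Set.Icc 0 B) y := fun y => by
    have := ((Complex.hasDerivAt_cos (ζ * y)).comp (y : ℂ)
      ((hasDerivAt_id (y : ℂ)).const_mul ζ)).comp_ofReal.hasDerivWithinAt (s := Set.Icc 0 B)
    simpa using this
  have hsin : ∀ y : ℝ, HasDerivWithinAt (fun y : ℝ => Complex.sin (ζ * y))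
      (Complex.cos (ζ * y) * ζ) (Set.Icc 0 B) y := fun y => by
    have := ((Complex.hasDerivAt_sin (ζ * y)).comp (y : ℂ)
      ((hasDerivAt_id (y : ℂ)).const_mul ζ)).comp_ofReal.hasDerivWithinAt (s := Set.Icc 0 B)
    simpa using this
  have h2 : ∀ y ∈ Set.Icc 0 B, HasDerivWithinAt (zext z.1.2.1) (-s * zext z.1.1 y)
      (Set.Icc 0 B) y := fun y hy => by
    refine (z.2.1 y hy).2.congr_deriv ?_
    rw [zext_of_mem _ hy, zext_of_mem _ hy, hz]
    simp
  have c1 := eq_of_hasDerivWithinAt_Icc_zero (g := fun y : ℝ =>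
    zext z.1.2.1 y * Complex.cos (ζ * y) + ζ * zext z.1.1 y * Complex.sin (ζ * y))
    (fun y hy => (((h2 y hy).mul (hcos y)).add
      (((z.2.1 y hy).1.const_mul ζ).mul (hsin y))).congr_deriv (by
        linear_combination (zext z.1.1 y * Complex.cos (ζ * y)) * hζ)) hx
  have c2 := eq_of_hasDerivWithinAt_Icc_zero (g := fun y : ℝ =>
    zext z.1.2.1 y * Complex.sin (ζ * y) - ζ * zext z.1.1 y * Complex.cos (ζ * y))
    (fun y hy => (((h2 y hy).mul (hsin y)).sub
      (((z.2.1 y hy).1.const_mul ζ).mul (hcos y))).congr_deriv (by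
        linear_combination (zext z.1.1 y * Complex.sin (ζ * y)) * hζ)) hx
  simp only [Complex.ofReal_zero, mul_zero, Complex.cos_zero, Complex.sin_zero, mul_one, add_zero,
    h0, sub_zero] at c1 c2
  have hcs := Complex.sin_sq_add_cos_sq (ζ * x)
  constructor
  · linear_combination Complex.cos (ζ * x) * c1 + Complex.sin (ζ * x) * c2 - zext z.1.2.1 x * hcs
  · linear_combination Complex.sin (ζ * x) * c1 - Complex.cos (ζ * x) * c2 - ζ * zext z.1.1 x * hcs

theorem dirichlet_eq_zero (hB : 0 < B) {z : schrodingerDom B dirichletL dirichletR}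
    (hz : z ∈ schrodingerEig (0 : IccFun B) dirichletL dirichletR s) (h0 : zext z.1.2.1 0 = 0) :
    z = 0 := by
  obtain ⟨ζ, hζ⟩ := IsAlgClosed.exists_pow_nat_eq (s : ℂ) (n := 2) two_pos
  have h1 : ∀ x ∈ Set.Icc 0 B, zext z.1.2.1 x = 0 := fun x hx => by
    rw [(dirichlet_eigenfunction hB hz hζ hx).1, h0, zero_mul]
  obtain ⟨hz0, -⟩ := (dirichlet_iff _ _).1 z.2.2
  simp only [Matrix.cons_val_zero] at hz0
  refine schrodingerDom_ext hB ?_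
  ext x
  have := eq_of_hasDerivWithinAt_Icc_zero (g := zext z.1.1)
    (fun y hy => (z.2.1 y hy).1.congr_deriv (h1 y hy)) x.2
  rw [hz0, zext_coe] at this
  simpa using this

theorem dirichlet_eigenvalue (hB : 0 < B) {z : schrodingerDom B dirichletL dirichletR}
    (hz : z ∈ schrodingerEig (0 : IccFun B) dirichletL dirichletR s) (hz0 : z ≠ 0) :
    ∃ k : ℕ, 1 ≤ k ∧ s = (k * Real.pi / B) ^ 2 := by
  obtain ⟨ζ, hζ⟩ := IsAlgClosed.exists_pow_nat_eq (s : ℂ) (n := 2) two_pos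
  have hc : zext z.1.2.1 0 ≠ 0 := fun h => hz0 (dirichlet_eq_zero hB hz h)
  have hBm : B ∈ Set.Icc 0 B := ⟨hB.le, le_rfl⟩
  obtain ⟨h0, hb⟩ := (dirichlet_iff _ _).1 z.2.2
  simp only [Matrix.cons_val_zero] at h0 hb
  have hBc : (B : ℂ) ≠ 0 := by exact_mod_cast hB.ne'
  -- For `ζ = 0` the sine relation is void, so this case is excluded separately: `f` would be linear
  -- with nonzero slope and could not vanish at both ends.
  have hζ0 : ζ ≠ 0 := by
    rintro rfl
    have h1 : ∀ x ∈ Set.Icc 0 B, zext z.1.2.1 x = zext z.1.2.1 0 := fun x hx => by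
      simpa using (dirichlet_eigenfunction hB hz hζ hx).1
    have := eq_of_hasDerivWithinAt_Icc_zero (g := fun x : ℝ => zext z.1.1 x - zext z.1.2.1 0 * x)
      (fun y hy => ((z.2.1 y hy).1.sub
        (((hasDerivAt_id (y : ℂ)).comp_ofReal.hasDerivWithinAt).const_mul _)).congr_deriv
          (by rw [h1 y hy]; ring)) hBm
    rw [h0, hb] at this
    simp at this
    exact this.elim hc hB.ne'
  have h1 := (dirichlet_eigenfunction hB hz hζ hBm).2
  rw [hb, mul_zero] at h1
  have h2 := (mul_eq_zero.1 h1.symm).resolve_left hc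
  obtain ⟨k, hk⟩ := Complex.sin_eq_zero_iff.1 h2
  have hζk : ζ = k * Real.pi / B := by rw [← hk]; field_simp
  refine ⟨k.natAbs, ?_, ?_⟩
  · rw [Nat.one_le_iff_ne_zero, Int.natAbs_ne_zero]
    rintro rfl
    simp at hζk
    exact hζ0 hζk
  · have h3 : (s : ℂ) = (((k : ℝ) * Real.pi / B : ℝ) : ℂ) ^ 2 := by
      rw [← hζ, hζk]; push_cast; rfl
    have h4 : s = ((k : ℝ) * Real.pi / B) ^ 2 := by exact_mod_cast h3
    rw [h4, div_pow, div_pow, mul_pow, mul_pow]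
    congr 2
    rw [Nat.cast_natAbs, Int.cast_abs, sq_abs]

/-- The functional `f ↦ f'(0)` is injective on the eigenspace and does not vanish on the
eigenfunction `sin (k π x / B)`. -/
theorem finrank_dirichlet_eq_one (hB : 0 < B) {k : ℕ} (hk : 1 ≤ k) :
    Module.finrank ℂ (schrodingerEig (0 : IccFun B) dirichletL dirichletR
      ((k * Real.pi / B) ^ 2)) = 1 := by
  set l : ℝ := k * Real.pi / B
  let φ : schrodingerEig (0 : IccFun B) dirichletL dirichletR (l ^ 2) →ₗ[ℂ] ℂ :=
    (LinearMap.proj 1 ∘ₗ boundaryValues B dirichletL dirichletR) ∘ₗ Submodule.subtype _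
  have hφ : ∀ z, φ z = zext z.1.1.2.1 0 := fun z => rfl
  have hinj : Function.Injective φ := by
    refine injective_of_eigSub (Y := schrodingerDom B dirichletL dirichletR) fun z hz => ?_
    exact Subtype.ext (dirichlet_eq_zero hB z.2 hz)
  have hl : 0 < l := by
    have : (0 : ℝ) < k := by exact_mod_cast hk
    have := Real.pi_pos
    positivity
  have hlin : ∀ x : ℝ, HasDerivWithinAt (fun x : ℝ => l * x) l (Set.Icc 0 B) x := fun x => by
    simpa using ((hasDerivAt_id x).const_mul l).hasDerivWithinAt (s := Set.Icc 0 B)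
  have h1 : ∀ x ∈ Set.Icc 0 B, HasDerivWithinAt (fun x : ℝ => ((Real.sin (l * x) : ℝ) : ℂ))
      (((Real.cos (l * x) * l : ℝ)) : ℂ) (Set.Icc 0 B) x := fun x _ =>
    ((hlin x).sin).ofReal_comp
  have h2 : ∀ x ∈ Set.Icc 0 B, HasDerivWithinAt (fun x : ℝ => ((Real.cos (l * x) * l : ℝ) : ℂ))
      ((((-Real.sin (l * x) * l) * l : ℝ)) : ℂ) (Set.Icc 0 B) x := fun x _ =>
    (((hlin x).cos).mul_const l).ofReal_comp
  have hlB : l * B = k * Real.pi := by simp only [l]; field_simp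
  obtain ⟨z, hz⟩ := exists_mem_schrodingerDom (M := dirichletL) (N := dirichletR) h1 h2
    (by fun_prop) hB.le ((dirichlet_iff _ _).2 (by simp [hlB, Real.sin_nat_mul_pi]))
  have hzm : z ∈ schrodingerEig (0 : IccFun B) dirichletL dirichletR (l ^ 2) := by
    rw [mem_schrodingerEig hB]
    intro x
    rw [(hz x).2.2, (hz x).1, ContinuousMap.zero_apply]
    push_cast
    ring
  have hφz : φ ⟨z, hzm⟩ ≠ 0 := by
    have h0 : (0 : ℝ) ∈ Set.Icc 0 B := ⟨le_rfl, hB.le⟩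
    rw [hφ, zext_of_mem _ h0, (hz ⟨0, h0⟩).2.1]
    simp [hl.ne']
  have hsurj : Function.Surjective φ := by
    intro c
    refine ⟨(c / φ ⟨z, hzm⟩) • ⟨z, hzm⟩, ?_⟩
    rw [map_smul, smul_eq_mul, div_mul_cancel₀ _ hφz]
  rw [(LinearEquiv.ofBijective φ ⟨hinj, hsurj⟩).finrank_eq, Module.finrank_self]

/-- There are no eigenvalues at or below `0`, so the left end `α` has no influence. This absorbs the
enlargement of windows in the comparison. -/
theorem finrank_dirichlet_window (hB : 0 < B) {T : IccL2 B →L[ℂ] IccL2 B} {μ : ℝ}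
    (h : HasCompactResolvent (Y := schrodingerDom B dirichletL dirichletR) (H := IccL2 B)
        (schrodingerVal B dirichletL dirichletR) (schrodingerOp 0 dirichletL dirichletR) T μ)
    {α t : ℝ} (hα : α ≤ 0) (ht : 0 ≤ t) :
    Module.finrank ℂ (schrodingerSpectralSub (0 : IccFun B) dirichletL dirichletR (Set.Icc α t)) =
      ⌊B * √t / Real.pi⌋₊ := by
  have hpi := Real.pi_pos
  rw [← h.finsum_finrank (Metric.isBounded_Icc α t)]
  set K := ⌊B * √t / Real.pi⌋₊
  have hinj : Function.Injective fun k : ℕ => ((k : ℝ) * Real.pi / B) ^ 2 := by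
    intro k k' hkk
    have h1 : (k : ℝ) * Real.pi / B = k' * Real.pi / B :=
      (pow_left_inj₀ (by positivity) (by positivity) two_ne_zero).1 hkk
    have h2 : (k : ℝ) = k' := by field_simp at h1; exact h1
    exact_mod_cast h2
  have hmem : ∀ k : ℕ, ((k : ℝ) * Real.pi / B) ^ 2 ≤ t ↔ k ≤ K := by
    intro k
    rw [Nat.le_floor_iff (by positivity), le_div_iff₀ hpi, ← Real.le_sqrt (by positivity),
      div_le_iff₀ hB, mul_comm B]
    exact ht
  rw [finsum_mem_eq_sum_of_inter_support_eq (t := (Finset.Icc 1 K).image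
    fun k : ℕ => ((k : ℝ) * Real.pi / B) ^ 2)]
  · rw [Finset.sum_image hinj.injOn, Finset.sum_congr rfl (g := fun _ => 1)]
    · simp
    · intro k hk
      exact finrank_dirichlet_eq_one hB (Finset.mem_Icc.1 hk).1
  · ext l
    simp only [Set.mem_inter_iff, Function.mem_support, Finset.coe_image, Set.mem_image,
      Finset.mem_coe, Finset.mem_Icc]
    constructor
    · rintro ⟨hl, hne⟩
      refine ⟨?_, hne⟩
      have hbot : schrodingerEig (0 : IccFun B) dirichletL dirichletR l ≠ ⊥ := fun hb =>
        hne (by rw [show eigSub _ _ l = _ from hb, finrank_bot])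
      obtain ⟨z, hz, hz0⟩ := (Submodule.ne_bot_iff _).1 hbot
      obtain ⟨k, hk, rfl⟩ := dirichlet_eigenvalue hB hz hz0
      exact ⟨k, ⟨hk, (hmem k).1 hl.2⟩, rfl⟩
    · rintro ⟨⟨k, ⟨hk1, hk2⟩, rfl⟩, hne⟩
      exact ⟨⟨hα.trans (sq_nonneg _), (hmem k).2 hk2⟩, hne⟩

end Dirichlet

/-! ### Weyl's law -/

/-- Inverting the counting estimate gives `((k - C)/β)² ≤ λ_k ≤ ((k + C)/β)²` for `k > C`.
Monotonicity of `N` is not needed: the upper point belongs to the set defining the infimum, and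
every member of that set obeys the lower bound. -/
theorem tendsto_div_kthNonneg {N : ℝ → ℕ} {β C : ℝ} (hβ : 0 < β)
    (h : ∀ t, 0 ≤ t → |(N t : ℝ) - β * √t| ≤ C) :
    Tendsto (fun k : ℕ => ((k : ℝ) ^ 2 / β ^ 2) / kthNonneg N k) atTop (𝓝 1) := by
  have hC : 0 ≤ C := (abs_nonneg _).trans (h 0 le_rfl)
  have hmem : ∀ k : ℕ, (((k : ℝ) + C) / β) ^ 2 ∈ {t : ℝ | 0 ≤ t ∧ k ≤ N t} := by
    intro k
    refine ⟨sq_nonneg _, ?_⟩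
    have h1 := (abs_le.1 (h _ (sq_nonneg (((k : ℝ) + C) / β)))).1
    rw [Real.sqrt_sq (by positivity), mul_div_cancel₀ _ hβ.ne'] at h1
    have h2 : (k : ℝ) ≤ N ((((k : ℝ) + C) / β) ^ 2) := by linarith
    exact_mod_cast h2
  have hlow : ∀ k : ℕ, C < k → (((k : ℝ) - C) / β) ^ 2 ≤ kthNonneg N k := by
    intro k hk
    refine le_csInf ⟨_, hmem k⟩ ?_
    rintro t ⟨ht0, ht⟩
    have h1 := (abs_le.1 (h t ht0)).2
    have h2 : (k : ℝ) ≤ N t := by exact_mod_cast ht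
    have h3 : ((k : ℝ) - C) / β ≤ √t := by
      rw [div_le_iff₀ hβ]; linarith
    have h4 : 0 ≤ ((k : ℝ) - C) / β := div_nonneg (by linarith) hβ.le
    calc (((k : ℝ) - C) / β) ^ 2 ≤ √t ^ 2 := by gcongr
      _ = t := Real.sq_sqrt ht0
  have hupp : ∀ k : ℕ, kthNonneg N k ≤ (((k : ℝ) + C) / β) ^ 2 := fun k =>
    csInf_le ⟨0, fun t ht => ht.1⟩ (hmem k)
  have l1 : Tendsto (fun k : ℕ => ((k : ℝ) / (k + C)) ^ 2) atTop (𝓝 1) := by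
    simpa using (tendsto_natCast_div_add_atTop C).pow 2
  have l2 : Tendsto (fun k : ℕ => ((k : ℝ) / (k + -C)) ^ 2) atTop (𝓝 1) := by
    simpa using (tendsto_natCast_div_add_atTop (-C)).pow 2
  refine tendsto_of_tendsto_of_tendsto_of_le_of_le' l1 l2 ?_ ?_
  · filter_upwards [eventually_gt_atTop ⌈C⌉₊] with k hk
    have hk' : C < k := Nat.lt_of_ceil_lt hk
    have h1 : 0 < (((k : ℝ) - C) / β) ^ 2 := by
      have : 0 < (k : ℝ) - C := by linarith
      positivity
    have h2 := h1.trans_le (hlow k hk')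
    calc ((k : ℝ) / (k + C)) ^ 2 = ((k : ℝ) ^ 2 / β ^ 2) / (((k : ℝ) + C) / β) ^ 2 := by
          have : 0 < (k : ℝ) + C := by linarith
          field_simp
      _ ≤ _ := by gcongr; exact hupp k
  · filter_upwards [eventually_gt_atTop ⌈C⌉₊] with k hk
    have hk' : C < k := Nat.lt_of_ceil_lt hk
    have h0 : 0 < (k : ℝ) - C := by linarith
    have h1 : 0 < (((k : ℝ) - C) / β) ^ 2 := by positivity
    calc _ ≤ ((k : ℝ) ^ 2 / β ^ 2) / (((k : ℝ) - C) / β) ^ 2 := by gcongr; exact hlow k hk'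
      _ = ((k : ℝ) / (k + -C)) ^ 2 := by
          rw [← sub_eq_add_neg]
          field_simp

theorem sqrt_add_le_add_sqrt {x y : ℝ} (hx : 0 ≤ x) (hy : 0 ≤ y) : √(x + y) ≤ √x + √y := by
  rw [Real.sqrt_le_iff]
  refine ⟨by positivity, ?_⟩
  nlinarith [Real.sq_sqrt hx, Real.sq_sqrt hy, Real.sqrt_nonneg x, Real.sqrt_nonneg y,
    mul_nonneg (Real.sqrt_nonneg x) (Real.sqrt_nonneg y)]

theorem exists_count_bound {B : ℝ} (hB : 0 < B) {V : ℝ → ℝ}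
    (hV : ContinuousOn V (Set.Icc 0 B)) {M N : Matrix (Fin 2) (Fin 2) ℂ}
    (hMN : IsotropicBC M N) :
    ∃ C : ℝ, ∀ t, 0 ≤ t →
      |((schrodingerProblem B V M N).count t : ℝ) - B / Real.pi * √t| ≤ C := by
  set Vc : IccFun B := iccRestrict (fun x => (V x : ℂ)) (Complex.continuous_ofReal.comp_continuousOn hV)
  have hVc : ∀ x, Vc x = (V x : ℂ) := fun x => rfl
  obtain ⟨T, μ, h⟩ := exists_hasCompactResolvent hB hV hVc hMN
  obtain ⟨T₀, μ₀, h₀⟩ := exists_hasCompactResolvent hB (V := fun _ => 0) continuousOn_const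
    (Vc := 0) (fun x => by simp) isotropicBC_dirichlet
  have hcount : ∀ t, (schrodingerProblem B V M N).count t =
      Module.finrank ℂ (schrodingerSpectralSub Vc M N (Set.Icc 0 t)) := by
    intro t
    rw [← h.finsum_finrank (Metric.isBounded_Icc 0 t)]
    unfold SturmLiouville.count
    simp only [finrank_eigenspace_schrodingerProblem hB hV hVc]
  set v := ‖Vc‖
  have hv0 : 0 ≤ v := norm_nonneg _
  have hv : ∀ x, ‖Vc x‖ ≤ v := fun x => Vc.norm_coe_le_norm x
  set F := Module.finrank ℂ (schrodingerSpectralSub Vc M N (Set.Icc (-(v + 1)) 0))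
  have hpi := Real.pi_pos
  have hβ : 0 < B / Real.pi := by positivity
  -- The `5` consists of four boundary conditions and one unit lost to the floor. `F` counts the
  -- eigenvalues in `[-(v + 1), 0]`, and the last term pays for shifting `t` by `v + 1`. The margin
  -- is `v + 1` rather than `v` because the comparison requires a strict inequality.
  refine ⟨5 + F + B / Real.pi * √(v + 1), fun t ht => ?_⟩
  rw [hcount, abs_le]
  constructor
  -- Lower bound: the Dirichlet window `[0, t - (v + 1)]` is compared with the window `[-(v + 1),
  -- t]`, whose part below `0` contributes at most `F`. For smaller `t` the constant alone exceeds
  -- `B√t/π`.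
  · by_cases htv : v + 1 ≤ t
    · have h1 := finrank_schrodingerSpectralSub_le (c := (t - (v + 1)) / 2)
        (r := (t - (v + 1)) / 2) (r' := (t - (v + 1)) / 2 + (v + 1)) h₀ h (v := v)
        (fun x => by simpa using hv x) (by linarith) (by linarith) (by linarith)
      have e1 : (t - (v + 1)) / 2 - (t - (v + 1)) / 2 = 0 := by ring
      have e2 : (t - (v + 1)) / 2 + (t - (v + 1)) / 2 = t - (v + 1) := by ring
      have e3 : (t - (v + 1)) / 2 - ((t - (v + 1)) / 2 + (v + 1)) = -(v + 1) := by ring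
      have e4 : (t - (v + 1)) / 2 + ((t - (v + 1)) / 2 + (v + 1)) = t := by ring
      rw [e1, e2, e3, e4, finrank_dirichlet_window hB h₀ le_rfl (by linarith),
        ← Set.Icc_union_Icc_eq_Icc (b := 0) (by linarith) ht] at h1
      have h2 := h1.trans (Nat.add_le_add_left
        (h.finrank_union (Metric.isBounded_Icc (-(v + 1)) 0) (Metric.isBounded_Icc 0 t)) 4)
      have h3 := Nat.lt_floor_add_one (B * √(t - (v + 1)) / Real.pi)
      have h4 : √t ≤ √(t - (v + 1)) + √(v + 1) := by
        have := sqrt_add_le_add_sqrt (x := t - (v + 1)) (y := v + 1) (by linarith) (by linarith)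
        rwa [sub_add_cancel] at this
      have h5 := mul_le_mul_of_nonneg_left h4 hβ.le
      have h6 : (⌊B * √(t - (v + 1)) / Real.pi⌋₊ : ℝ) ≤ 4 + (F +
          Module.finrank ℂ (schrodingerSpectralSub Vc M N (Set.Icc 0 t))) := by exact_mod_cast h2
      have h7 : B * √(t - (v + 1)) / Real.pi = B / Real.pi * √(t - (v + 1)) := by ring
      rw [h7] at h3 h6
      linarith
    · have h1 : √t ≤ √(v + 1) := Real.sqrt_le_sqrt (by linarith)
      have h2 := mul_le_mul_of_nonneg_left h1 hβ.le
      have h3 : (0 : ℝ) ≤ Module.finrank ℂ (schrodingerSpectralSub Vc M N (Set.Icc 0 t)) :=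
        Nat.cast_nonneg _
      have h4 : (0 : ℝ) ≤ F := Nat.cast_nonneg _
      linarith
  -- Upper bound: the window `[0, t]` is compared with the Dirichlet window `[-(v + 1), t + (v +
  -- 1)]`.
  · have h1 := finrank_schrodingerSpectralSub_le (c := t / 2) (r := t / 2)
      (r' := t / 2 + (v + 1)) h h₀ (v := v) (fun x => by simpa using hv x) (by linarith)
      (by linarith) (by linarith)
    have e1 : t / 2 - t / 2 = 0 := by ring
    have e2 : t / 2 + t / 2 = t := by ring
    have e3 : t / 2 - (t / 2 + (v + 1)) = -(v + 1) := by ring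
    have e4 : t / 2 + (t / 2 + (v + 1)) = t + (v + 1) := by ring
    rw [e1, e2, e3, e4, finrank_dirichlet_window hB h₀ (by linarith) (by linarith)] at h1
    have h2 : (Module.finrank ℂ (schrodingerSpectralSub Vc M N (Set.Icc 0 t)) : ℝ) ≤
        4 + ⌊B * √(t + (v + 1)) / Real.pi⌋₊ := by exact_mod_cast h1
    have h3 := Nat.floor_le (a := B * √(t + (v + 1)) / Real.pi) (by positivity)
    have h4 := mul_le_mul_of_nonneg_left
      (sqrt_add_le_add_sqrt ht (show 0 ≤ v + 1 by linarith)) hβ.le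
    have h5 : B * √(t + (v + 1)) / Real.pi = B / Real.pi * √(t + (v + 1)) := by ring
    have h6 : (0 : ℝ) ≤ F := Nat.cast_nonneg _
    rw [h5] at h2 h3
    linarith

theorem tendsto_div_eig_schrodingerProblem {B : ℝ} (hB : 0 < B) {V : ℝ → ℝ}
    (hV : ContinuousOn V (Set.Icc 0 B)) {M N : Matrix (Fin 2) (Fin 2) ℂ}
    (hMN : IsotropicBC M N) :
    Tendsto (fun k : ℕ => ((k : ℝ) ^ 2 * Real.pi ^ 2 / B ^ 2) /
      (schrodingerProblem B V M N).eig k) atTop (𝓝 1) := by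
  obtain ⟨C, hC⟩ := exists_count_bound hB hV hMN
  have hpi := Real.pi_pos
  refine (tendsto_div_kthNonneg (div_pos hB hpi) hC).congr fun k => ?_
  rw [SturmLiouville.eig, div_pow, div_div_eq_mul_div]

/-! ### The Liouville transformation -/

namespace SturmLiouville

variable {P : SturmLiouville}

/-- A solution is determined by a first-order system for `(u, p u')`. -/
theorem IsSolution.of_hasDerivWithinAt (hlt : P.a < P.b) (hp : ∀ x ∈ P.dom, 0 < P.p x)
    (hw : ∀ x ∈ P.dom, 0 < P.w x) {s : ℝ} {u z : ℝ → ℂ} (h0 : ∀ x, x ∉ P.dom → u x = 0)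
    (h1 : ∀ x ∈ P.dom, HasDerivWithinAt u (z x / P.p x) P.dom x)
    (h2 : ∀ x ∈ P.dom, HasDerivWithinAt z ((P.q x - s * P.w x) * u x) P.dom x)
    (hbc : P.bcL.mulVec ![u P.a, z P.a] + P.bcR.mulVec ![u P.b, z P.b] = 0) :
    P.IsSolution s u := by
  have hq : ∀ x ∈ P.dom, P.quasiDeriv u x = z x := by
    intro x hx
    have hpx : (P.p x : ℂ) ≠ 0 := Complex.ofReal_ne_zero.2 (hp x hx).ne'
    rw [quasiDeriv, (h1 x hx).derivWithin (uniqueDiffOn_Icc hlt x hx)]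
    field_simp
  have h3 : ∀ x ∈ P.dom,
      HasDerivWithinAt (P.quasiDeriv u) ((P.q x - s * P.w x) * u x) P.dom x :=
    fun x hx => (h2 x hx).congr hq (hq x hx)
  refine ⟨h0, fun x hx => (h1 x hx).differentiableWithinAt,
    fun x hx => (h3 x hx).differentiableWithinAt, ?_, fun x hx => ?_⟩
  · rw [SatisfiesBC, hq _ (Set.left_mem_Icc.2 hlt.le), hq _ (Set.right_mem_Icc.2 hlt.le)]
    exact hbc
  · have hwx : (P.w x : ℂ) ≠ 0 := Complex.ofReal_ne_zero.2 (hw x hx).ne'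
    rw [expr, (h3 x hx).derivWithin (uniqueDiffOn_Icc hlt x hx)]
    field_simp
    ring

theorem IsSolution.hasDerivWithinAt (hp : ∀ x ∈ P.dom, 0 < P.p x) {s : ℝ} {u : ℝ → ℂ}
    (h : P.IsSolution s u) {x : ℝ} (hx : x ∈ P.dom) :
    HasDerivWithinAt u (P.quasiDeriv u x / P.p x) P.dom x := by
  have hpx : (P.p x : ℂ) ≠ 0 := Complex.ofReal_ne_zero.2 (hp x hx).ne'
  refine (h.diff x hx).hasDerivWithinAt.congr_deriv ?_
  rw [quasiDeriv]
  field_simp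

theorem IsSolution.hasDerivWithinAt_quasiDeriv (hw : ∀ x ∈ P.dom, 0 < P.w x) {s : ℝ}
    {u : ℝ → ℂ} (h : P.IsSolution s u) {x : ℝ} (hx : x ∈ P.dom) :
    HasDerivWithinAt (P.quasiDeriv u) ((P.q x - s * P.w x) * u x) P.dom x := by
  have hwx : (P.w x : ℂ) ≠ 0 := Complex.ofReal_ne_zero.2 (hw x hx).ne'
  refine (h.diff_quasi x hx).hasDerivWithinAt.congr_deriv ?_
  have h3 := h.eqn x hx
  rw [expr] at h3
  field_simp at h3
  linear_combination -h3

/-- The density `√(w/p)` of the Liouville variable. -/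
def density (P : SturmLiouville) (x : ℝ) : ℝ := √(P.w x / P.p x)

namespace IsRegular

theorem density_pos (hP : P.IsRegular) {x : ℝ} (hx : x ∈ P.dom) : 0 < P.density x :=
  Real.sqrt_pos.2 (div_pos (hP.w_pos x hx) (hP.p_pos x hx))

theorem continuousOn_density (hP : P.IsRegular) : ContinuousOn P.density P.dom :=
  (hP.contDiffOn_w.continuousOn.div hP.contDiffOn_p.continuousOn
    fun x hx => (hP.p_pos x hx).ne').sqrt

theorem weight_pos (hP : P.IsRegular) {x : ℝ} (hx : x ∈ P.dom) : 0 < P.weight x :=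
  Real.rpow_pos_of_pos (mul_pos (hP.p_pos x hx) (hP.w_pos x hx)) _

theorem p_mul_density (hP : P.IsRegular) {x : ℝ} (hx : x ∈ P.dom) :
    P.p x * P.density x = P.weight x ^ 2 := by
  have hp := hP.p_pos x hx
  have hw := hP.w_pos x hx
  rw [weight, ← Real.rpow_natCast, ← Real.rpow_mul (mul_pos hp hw).le, density]
  norm_num
  rw [← Real.sqrt_eq_rpow, Real.sqrt_mul hp.le, Real.sqrt_div hw.le]
  nth_rewrite 1 [← Real.mul_self_sqrt hp.le]
  have := (Real.sqrt_pos.2 hp).ne'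
  field_simp

theorem w_eq (hP : P.IsRegular) {x : ℝ} (hx : x ∈ P.dom) :
    P.w x = P.weight x ^ 2 * P.density x := by
  have hp := hP.p_pos x hx
  rw [← hP.p_mul_density hx, mul_assoc, density, Real.mul_self_sqrt
    (div_pos (hP.w_pos x hx) hp).le, mul_div_cancel₀ _ hp.ne']

theorem derivWithin_eq (hP : P.IsRegular) (f : ℝ → ℝ) {x : ℝ} (hx : x ∈ P.dom) :
    derivWithin f P.dom x = P.density x * P.derivY f x := by
  have hp := hP.p_pos x hx
  have hw := hP.w_pos x hx
  rw [derivY, density, ← mul_assoc, ← Real.sqrt_mul (div_pos hw hp).le]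
  have : P.w x / P.p x * (P.p x / P.w x) = 1 := by field_simp
  rw [this, Real.sqrt_one, one_mul]

theorem contDiffOn_weight (hP : P.IsRegular) : ContDiffOn ℝ 2 P.weight P.dom :=
  hP.contDiffOn_pw.rpow_const_of_ne fun x hx => (mul_pos (hP.p_pos x hx) (hP.w_pos x hx)).ne'

/-- As `p w` is `C²`, so is `m`, while the factor `√(p/w)` is only `C¹`. This is just enough for a
second derivative in `y`, and hence for a continuous potential. -/
theorem contDiffOn_derivY_weight (hP : P.IsRegular) :
    ContDiffOn ℝ 1 (P.derivY P.weight) P.dom := by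
  refine ContDiffOn.mul ?_ (hP.contDiffOn_weight.derivWithin (uniqueDiffOn_Icc hP.lt) (by norm_num))
  exact (hP.contDiffOn_p.div hP.contDiffOn_w fun x hx => (hP.w_pos x hx).ne').sqrt
    fun x hx => (div_pos (hP.p_pos x hx) (hP.w_pos x hx)).ne'

theorem continuousOn_derivY_derivY_weight (hP : P.IsRegular) :
    ContinuousOn (P.derivY (P.derivY P.weight)) P.dom := by
  refine ContinuousOn.mul ?_
    (hP.contDiffOn_derivY_weight.continuousOn_derivWithin (uniqueDiffOn_Icc hP.lt) le_rfl)
  exact (hP.contDiffOn_p.continuousOn.div hP.contDiffOn_w.continuousOn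
    fun x hx => (hP.w_pos x hx).ne').sqrt

theorem hasDerivWithinAt_weight (hP : P.IsRegular) {x : ℝ} (hx : x ∈ P.dom) :
    HasDerivWithinAt P.weight (P.density x * P.derivY P.weight x) P.dom x := by
  rw [← hP.derivWithin_eq _ hx]
  exact ((hP.contDiffOn_weight.differentiableOn (by norm_num)) x hx).hasDerivWithinAt

theorem hasDerivWithinAt_derivY_weight (hP : P.IsRegular) {x : ℝ} (hx : x ∈ P.dom) :
    HasDerivWithinAt (P.derivY P.weight) (P.density x * P.derivY (P.derivY P.weight) x)
      P.dom x := by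
  rw [← hP.derivWithin_eq _ hx]
  exact ((hP.contDiffOn_derivY_weight.differentiableOn (by norm_num)) x hx).hasDerivWithinAt

theorem hasDerivWithinAt_liouvilleVar (hP : P.IsRegular) {x : ℝ} (hx : x ∈ P.dom) :
    HasDerivWithinAt P.liouvilleVar (P.density x) P.dom x :=
  hasDerivWithinAt_integral_Icc hP.continuousOn_density hx

theorem continuousOn_liouvilleVar (hP : P.IsRegular) : ContinuousOn P.liouvilleVar P.dom :=
  fun _ hx => (hP.hasDerivWithinAt_liouvilleVar hx).continuousWithinAt

theorem liouvilleVar_left (P : SturmLiouville) : P.liouvilleVar P.a = 0 :=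
  intervalIntegral.integral_same

theorem left_mem (hP : P.IsRegular) : P.a ∈ P.dom := Set.left_mem_Icc.2 hP.lt.le

theorem right_mem (hP : P.IsRegular) : P.b ∈ P.dom := Set.right_mem_Icc.2 hP.lt.le

/-- The constant is the minimum of the positive continuous density on the compact interval. The
estimate yields strict monotonicity of the Liouville variable and a Lipschitz bound for its inverse.
-/
theorem exists_le_liouvilleVar_sub (hP : P.IsRegular) :
    ∃ c > 0, ∀ x ∈ P.dom, ∀ x' ∈ P.dom, x ≤ x' →
      c * (x' - x) ≤ P.liouvilleVar x' - P.liouvilleVar x := by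
  obtain ⟨x₀, hx₀, hmin⟩ := isCompact_Icc.exists_isMinOn ⟨_, hP.left_mem⟩ hP.continuousOn_density
  refine ⟨P.density x₀, hP.density_pos hx₀, fun x hx x' hx' hxx => ?_⟩
  have hint : ∀ y ∈ P.dom, ∀ z ∈ P.dom, IntervalIntegrable P.density volume y z :=
    fun y hy z hz => (hP.continuousOn_density.mono
      (Set.uIcc_subset_Icc hy hz)).intervalIntegrable
  have e : P.liouvilleVar x' - P.liouvilleVar x = ∫ t in x..x', P.density t :=
    intervalIntegral.integral_interval_sub_left (hint _ hP.left_mem _ hx')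
      (hint _ hP.left_mem _ hx)
  rw [e]
  have h := intervalIntegral.integral_mono_on hxx intervalIntegrable_const (hint _ hx _ hx')
    fun t ht => hmin (show t ∈ P.dom from ⟨hx.1.trans ht.1, ht.2.trans hx'.2⟩)
  simpa [mul_comm] using h

theorem strictMonoOn_liouvilleVar (hP : P.IsRegular) : StrictMonoOn P.liouvilleVar P.dom := by
  obtain ⟨c, hc, h⟩ := hP.exists_le_liouvilleVar_sub
  intro x hx x' hx' hxx
  have := h x hx x' hx' hxx.le
  nlinarith [mul_pos hc (sub_pos.2 hxx)]

theorem B_pos (hP : P.IsRegular) : 0 < P.B := by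
  have := hP.strictMonoOn_liouvilleVar hP.left_mem hP.right_mem hP.lt
  rwa [liouvilleVar_left] at this

theorem bijOn_liouvilleVar (hP : P.IsRegular) :
    Set.BijOn P.liouvilleVar P.dom (Set.Icc 0 P.B) := by
  refine ⟨fun x hx => ⟨?_, ?_⟩, hP.strictMonoOn_liouvilleVar.injOn, ?_⟩
  · rw [← liouvilleVar_left P]
    exact hP.strictMonoOn_liouvilleVar.monotoneOn hP.left_mem hx hx.1
  · exact hP.strictMonoOn_liouvilleVar.monotoneOn hx hP.right_mem hx.2
  · have := intermediate_value_Icc hP.lt.le hP.continuousOn_liouvilleVar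
    rwa [liouvilleVar_left] at this

end IsRegular

/-- The inverse of the Liouville variable. -/
def liouvilleInv (P : SturmLiouville) : ℝ → ℝ := Function.invFunOn P.liouvilleVar P.dom

namespace IsRegular

theorem invOn_liouvilleInv (hP : P.IsRegular) :
    Set.InvOn P.liouvilleInv P.liouvilleVar P.dom (Set.Icc 0 P.B) :=
  hP.bijOn_liouvilleVar.invOn_invFunOn

theorem liouvilleInv_mem (hP : P.IsRegular) {y : ℝ} (hy : y ∈ Set.Icc 0 P.B) :
    P.liouvilleInv y ∈ P.dom :=
  hP.bijOn_liouvilleVar.surjOn.mapsTo_invFunOn hy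

theorem liouvilleInv_zero (hP : P.IsRegular) : P.liouvilleInv 0 = P.a := by
  rw [← liouvilleVar_left P]
  exact hP.invOn_liouvilleInv.1 hP.left_mem

theorem liouvilleInv_B (hP : P.IsRegular) : P.liouvilleInv P.B = P.b :=
  hP.invOn_liouvilleInv.1 hP.right_mem

theorem continuousOn_liouvilleInv (hP : P.IsRegular) :
    ContinuousOn P.liouvilleInv (Set.Icc 0 P.B) := by
  obtain ⟨c, hc, h⟩ := hP.exists_le_liouvilleVar_sub
  have key : ∀ y ∈ Set.Icc 0 P.B, ∀ y' ∈ Set.Icc 0 P.B, P.liouvilleInv y ≤ P.liouvilleInv y' →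
      |P.liouvilleInv y' - P.liouvilleInv y| ≤ c⁻¹ * |y' - y| := by
    intro y hy y' hy' hle
    have h1 := h _ (hP.liouvilleInv_mem hy) _ (hP.liouvilleInv_mem hy') hle
    rw [hP.invOn_liouvilleInv.2 hy, hP.invOn_liouvilleInv.2 hy'] at h1
    rw [abs_of_nonneg (sub_nonneg.2 hle), ← div_eq_inv_mul, le_div_iff₀' hc]
    exact h1.trans (le_abs_self _)
  refine (LipschitzOnWith.of_dist_le_mul (K := ⟨c⁻¹, (inv_pos.2 hc).le⟩)
    fun y hy y' hy' => ?_).continuousOn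
  rw [Real.dist_eq, Real.dist_eq]
  rcases le_total (P.liouvilleInv y') (P.liouvilleInv y) with hle | hle
  · exact key y' hy' y hy hle
  · rw [abs_sub_comm, abs_sub_comm y]
    exact key y hy y' hy' hle

theorem hasDerivWithinAt_liouvilleInv (hP : P.IsRegular) {y : ℝ} (hy : y ∈ Set.Icc 0 P.B) :
    HasDerivWithinAt P.liouvilleInv (P.density (P.liouvilleInv y))⁻¹ (Set.Icc 0 P.B) y := by
  have hx := hP.liouvilleInv_mem hy
  have ht : Tendsto P.liouvilleInv (𝓝[Set.Icc 0 P.B] y) (𝓝[P.dom] (P.liouvilleInv y)) :=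
    tendsto_nhdsWithin_iff.2 ⟨hP.continuousOn_liouvilleInv y hy,
      eventually_nhdsWithin_of_forall fun z hz => hP.liouvilleInv_mem hz⟩
  refine (HasFDerivWithinAt.of_local_left_inverse (f := P.liouvilleVar)
    (f' := ContinuousLinearEquiv.unitsEquivAut ℝ (Units.mk0 _ (hP.density_pos hx).ne')) ht ?_
    hy ?_).hasDerivWithinAt.congr_deriv ?_
  · exact (hP.hasDerivWithinAt_liouvilleVar hx).hasFDerivWithinAt
  · exact eventually_nhdsWithin_of_forall fun z hz => hP.invOn_liouvilleInv.2 hz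
  · simp

theorem continuousOn_potential (hP : P.IsRegular) :
    ContinuousOn P.potential (Set.Icc 0 P.B) := by
  have h : ContinuousOn (fun x => P.q x / P.w x + P.derivY (P.derivY P.weight) x / P.weight x)
      P.dom :=
    (hP.continuousOn_q.div hP.contDiffOn_w.continuousOn fun x hx => (hP.w_pos x hx).ne').add
      (hP.continuousOn_derivY_derivY_weight.div hP.contDiffOn_weight.continuousOn
        fun x hx => (hP.weight_pos hx).ne')
  exact h.comp hP.continuousOn_liouvilleInv fun y hy => hP.liouvilleInv_mem hy

theorem potential_liouvilleVar (hP : P.IsRegular) {x : ℝ} (hx : x ∈ P.dom) :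
    P.potential (P.liouvilleVar x) =
      P.q x / P.w x + P.derivY (P.derivY P.weight) x / P.weight x := by
  have h : P.liouvilleInv (P.liouvilleVar x) = x := hP.invOn_liouvilleInv.1 hx
  rw [liouvilleInv] at h
  simp only [potential, h]

/-- The identity `p √(w/p) = m²` turns `p m' / m²` into `dm/dy`, the form in which the
transformation is computed below. -/
theorem mulVec_transition (hP : P.IsRegular) {x : ℝ} (hx : x ∈ P.dom) (v v1 : ℂ) :
    (P.transition x).mulVec ![v, v1] =
      ![v / P.weight x, P.weight x * v1 - P.derivY P.weight x * v] := by
  have hm : (P.weight x : ℂ) ≠ 0 := Complex.ofReal_ne_zero.2 (hP.weight_pos hx).ne'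
  have h : P.p x * derivWithin P.weight P.dom x / P.weight x ^ 2 = P.derivY P.weight x := by
    rw [hP.derivWithin_eq _ hx, ← mul_assoc, hP.p_mul_density hx,
      mul_div_cancel_left₀ _ (pow_ne_zero 2 (hP.weight_pos hx).ne')]
  rw [transition, h]
  ext i
  fin_cases i <;> simp [Matrix.mulVec, dotProduct] <;> ring

end IsRegular

/-- The Liouville transformation `u ↦ m u`, read in the Liouville variable. -/
def toNormalForm (P : SturmLiouville) : (ℝ → ℂ) →ₗ[ℂ] (ℝ → ℂ) where
  toFun u := (Set.Icc 0 P.B).indicator fun y => P.weight (P.liouvilleInv y) * u (P.liouvilleInv y)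
  map_add' u v := by
    funext y
    by_cases hy : y ∈ Set.Icc 0 P.B <;> simp [hy, mul_add]
  map_smul' c u := by
    funext y
    by_cases hy : y ∈ Set.Icc 0 P.B <;> simp [hy, mul_left_comm]

/-- The inverse Liouville transformation `v ↦ v / m`. -/
def ofNormalForm (P : SturmLiouville) : (ℝ → ℂ) →ₗ[ℂ] (ℝ → ℂ) where
  toFun v := P.dom.indicator fun x => v (P.liouvilleVar x) / P.weight x
  map_add' u v := by
    funext x
    by_cases hx : x ∈ P.dom <;> simp [hx, add_div]
  map_smul' c u := by
    funext x
    by_cases hx : x ∈ P.dom <;> simp [hx, mul_div_assoc]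

theorem toNormalForm_of_mem (u : ℝ → ℂ) {y : ℝ} (hy : y ∈ Set.Icc 0 P.B) :
    P.toNormalForm u y = P.weight (P.liouvilleInv y) * u (P.liouvilleInv y) := by
  simp only [toNormalForm, LinearMap.coe_mk, AddHom.coe_mk, Set.indicator_of_mem hy]

theorem toNormalForm_of_notMem (u : ℝ → ℂ) {y : ℝ} (hy : y ∉ Set.Icc 0 P.B) :
    P.toNormalForm u y = 0 := by
  simp only [toNormalForm, LinearMap.coe_mk, AddHom.coe_mk, Set.indicator_of_notMem hy]

theorem ofNormalForm_of_mem (v : ℝ → ℂ) {x : ℝ} (hx : x ∈ P.dom) :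
    P.ofNormalForm v x = v (P.liouvilleVar x) / P.weight x := by
  simp only [ofNormalForm, LinearMap.coe_mk, AddHom.coe_mk, Set.indicator_of_mem hx]

theorem ofNormalForm_of_notMem (v : ℝ → ℂ) {x : ℝ} (hx : x ∉ P.dom) :
    P.ofNormalForm v x = 0 := by
  simp only [ofNormalForm, LinearMap.coe_mk, AddHom.coe_mk, Set.indicator_of_notMem hx]

namespace IsRegular

theorem isSolution_toNormalForm (hP : P.IsRegular) {s : ℝ} {u : ℝ → ℂ} (hu : P.IsSolution s u) :
    P.normalForm.IsSolution s (P.toNormalForm u) := by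
  set z := P.quasiDeriv u
  -- This is `dv/dy` for `v = m u`: the product rule gives `(dm/dy) u + m du/dy`, and `m du/dy = p
  -- u' / m`.
  let g : ℝ → ℂ := fun x => P.derivY P.weight x * u x + z x / P.weight x
  have hg : ∀ x ∈ P.dom, (P.transition x).mulVec ![P.weight x * u x, g x] = ![u x, z x] := by
    intro x hx
    have hm : (P.weight x : ℂ) ≠ 0 := Complex.ofReal_ne_zero.2 (hP.weight_pos hx).ne'
    rw [hP.mulVec_transition hx]
    congr 2
    · field_simp
    · simp only [g]
      field_simp
      ring
  have hB0 : (0 : ℝ) ∈ Set.Icc 0 P.B := Set.left_mem_Icc.2 hP.B_pos.le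
  have hB1 : P.B ∈ Set.Icc 0 P.B := Set.right_mem_Icc.2 hP.B_pos.le
  refine IsSolution.of_hasDerivWithinAt (P := P.normalForm) (z := fun y => g (P.liouvilleInv y))
    hP.B_pos (fun _ _ => one_pos) (fun _ _ => one_pos) (fun y hy => toNormalForm_of_notMem u hy)
    (fun y hy => ?_) (fun y hy => ?_) ?_
  · change y ∈ Set.Icc 0 P.B at hy
    have hx := hP.liouvilleInv_mem hy
    have hθ : (P.density (P.liouvilleInv y) : ℂ) ≠ 0 :=
      Complex.ofReal_ne_zero.2 (hP.density_pos hx).ne'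
    have hm : (P.weight (P.liouvilleInv y) : ℂ) ≠ 0 :=
      Complex.ofReal_ne_zero.2 (hP.weight_pos hx).ne'
    have hp : (P.p (P.liouvilleInv y) : ℂ) ≠ 0 := Complex.ofReal_ne_zero.2 (hP.p_pos _ hx).ne'
    have e : (P.p (P.liouvilleInv y) : ℂ) * P.density (P.liouvilleInv y) =
        P.weight (P.liouvilleInv y) ^ 2 := by exact_mod_cast hP.p_mul_density hx
    have h := ((hP.hasDerivWithinAt_weight hx).ofReal_comp.mul
      (hu.hasDerivWithinAt hP.p_pos hx)).scomp (s := Set.Icc 0 P.B) y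
      (hP.hasDerivWithinAt_liouvilleInv hy) fun t ht => hP.liouvilleInv_mem ht
    refine (h.congr (fun t ht => toNormalForm_of_mem u ht)
      (toNormalForm_of_mem u hy)).congr_deriv ?_
    change _ = g _ / ((1 : ℝ) : ℂ)
    simp only [g, Complex.real_smul]
    push_cast
    field_simp
    linear_combination (-z (P.liouvilleInv y)) * e
  · change y ∈ Set.Icc 0 P.B at hy
    have hx := hP.liouvilleInv_mem hy
    have hθ : (P.density (P.liouvilleInv y) : ℂ) ≠ 0 :=
      Complex.ofReal_ne_zero.2 (hP.density_pos hx).ne'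
    have hm : (P.weight (P.liouvilleInv y) : ℂ) ≠ 0 :=
      Complex.ofReal_ne_zero.2 (hP.weight_pos hx).ne'
    have hp : (P.p (P.liouvilleInv y) : ℂ) ≠ 0 := Complex.ofReal_ne_zero.2 (hP.p_pos _ hx).ne'
    have e : (P.p (P.liouvilleInv y) : ℂ) =
        P.weight (P.liouvilleInv y) ^ 2 / P.density (P.liouvilleInv y) := by
      rw [eq_div_iff hθ]
      exact_mod_cast hP.p_mul_density hx
    have ew : (P.w (P.liouvilleInv y) : ℂ) =
        P.weight (P.liouvilleInv y) ^ 2 * P.density (P.liouvilleInv y) := by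
      exact_mod_cast hP.w_eq hx
    have h := (((hP.hasDerivWithinAt_derivY_weight hx).ofReal_comp.mul
      (hu.hasDerivWithinAt hP.p_pos hx)).add
      ((hu.hasDerivWithinAt_quasiDeriv hP.w_pos hx).div
        (hP.hasDerivWithinAt_weight hx).ofReal_comp hm)).scomp (s := Set.Icc 0 P.B) y
      (hP.hasDerivWithinAt_liouvilleInv hy) fun t ht => hP.liouvilleInv_mem ht
    refine h.congr_deriv ?_
    rw [toNormalForm_of_mem u hy]
    change _ = ((P.potential y : ℂ) - s * ((1 : ℝ) : ℂ)) * _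
    have hpot := hP.potential_liouvilleVar hx
    rw [hP.invOn_liouvilleInv.2 hy] at hpot
    rw [hpot]
    simp only [Complex.real_smul]
    push_cast
    rw [e, ew]
    field_simp
    ring
  · change (P.bcL * P.transition P.a).mulVec ![P.toNormalForm u 0, g (P.liouvilleInv 0)] +
      (P.bcR * P.transition P.b).mulVec ![P.toNormalForm u P.B, g (P.liouvilleInv P.B)] = 0
    rw [toNormalForm_of_mem u hB0, toNormalForm_of_mem u hB1, hP.liouvilleInv_zero,
      hP.liouvilleInv_B, ← Matrix.mulVec_mulVec, ← Matrix.mulVec_mulVec, hg _ hP.left_mem,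
      hg _ hP.right_mem]
    exact hu.bc

theorem isSolution_ofNormalForm (hP : P.IsRegular) {s : ℝ} {v : ℝ → ℂ}
    (hv : P.normalForm.IsSolution s v) : P.IsSolution s (P.ofNormalForm v) := by
  set v1 := P.normalForm.quasiDeriv v
  have hd : ∀ x ∈ P.dom, HasDerivWithinAt (fun x => v (P.liouvilleVar x))
      (P.density x * v1 (P.liouvilleVar x)) P.dom x := by
    intro x hx
    have h1 := hv.hasDerivWithinAt (fun _ _ => one_pos) (hP.bijOn_liouvilleVar.mapsTo hx)
    refine (h1.scomp (s := P.dom) x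
      (hP.hasDerivWithinAt_liouvilleVar hx) hP.bijOn_liouvilleVar.mapsTo).congr_deriv ?_
    change _ • (_ / ((1 : ℝ) : ℂ)) = _
    simp [v1]
  have hd1 : ∀ x ∈ P.dom, HasDerivWithinAt (fun x => v1 (P.liouvilleVar x))
      (P.density x * ((P.potential (P.liouvilleVar x) - s) * v (P.liouvilleVar x))) P.dom x := by
    intro x hx
    have h1 := hv.hasDerivWithinAt_quasiDeriv (fun _ _ => one_pos)
      (hP.bijOn_liouvilleVar.mapsTo hx)
    refine (h1.scomp (s := P.dom) x
      (hP.hasDerivWithinAt_liouvilleVar hx) hP.bijOn_liouvilleVar.mapsTo).congr_deriv ?_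
    change _ • (((P.potential (P.liouvilleVar x) : ℂ) - s * ((1 : ℝ) : ℂ)) * _) = _
    simp
  refine IsSolution.of_hasDerivWithinAt (z := fun x => P.weight x * v1 (P.liouvilleVar x) -
      P.derivY P.weight x * v (P.liouvilleVar x))
    hP.lt hP.p_pos hP.w_pos (fun x hx => ofNormalForm_of_notMem v hx)
    (fun x hx => ?_) (fun x hx => ?_) ?_
  · have hθ : (P.density x : ℂ) ≠ 0 := Complex.ofReal_ne_zero.2 (hP.density_pos hx).ne'
    have hm : (P.weight x : ℂ) ≠ 0 := Complex.ofReal_ne_zero.2 (hP.weight_pos hx).ne'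
    have e : (P.p x : ℂ) = P.weight x ^ 2 / P.density x := by
      rw [eq_div_iff hθ]
      exact_mod_cast hP.p_mul_density hx
    refine (((hd x hx).div (hP.hasDerivWithinAt_weight hx).ofReal_comp hm).congr
      (fun t ht => ofNormalForm_of_mem v ht) (ofNormalForm_of_mem v hx)).congr_deriv ?_
    push_cast
    rw [e]
    field_simp
  · have hθ : (P.density x : ℂ) ≠ 0 := Complex.ofReal_ne_zero.2 (hP.density_pos hx).ne'
    have hm : (P.weight x : ℂ) ≠ 0 := Complex.ofReal_ne_zero.2 (hP.weight_pos hx).ne'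
    have ew : (P.w x : ℂ) = P.weight x ^ 2 * P.density x := by
      exact_mod_cast hP.w_eq hx
    refine (((hP.hasDerivWithinAt_weight hx).ofReal_comp.mul (hd1 x hx)).sub
      ((hP.hasDerivWithinAt_derivY_weight hx).ofReal_comp.mul (hd x hx))).congr_deriv ?_
    rw [ofNormalForm_of_mem v hx, hP.potential_liouvilleVar hx]
    push_cast
    rw [ew]
    field_simp
    ring
  · have h := hv.bc
    change (P.bcL * P.transition P.a).mulVec ![v 0, v1 0] +
      (P.bcR * P.transition P.b).mulVec ![v P.B, v1 P.B] = 0 at h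
    rw [← Matrix.mulVec_mulVec, ← Matrix.mulVec_mulVec, hP.mulVec_transition hP.left_mem,
      hP.mulVec_transition hP.right_mem] at h
    rw [ofNormalForm_of_mem v hP.left_mem, ofNormalForm_of_mem v hP.right_mem, liouvilleVar_left]
    exact h

/-- The Liouville transformation is an isomorphism of eigenspaces. -/
def eigenspaceEquiv (hP : P.IsRegular) (s : ℝ) :
    P.eigenspace s ≃ₗ[ℂ] P.normalForm.eigenspace s :=
  LinearEquiv.ofLinearMap
    (P.toNormalForm.restrict (q := P.normalForm.eigenspace s)
      fun _ hu => hP.isSolution_toNormalForm hu)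
    (P.ofNormalForm.restrict (q := P.eigenspace s) fun _ hv => hP.isSolution_ofNormalForm hv)
    (by
      ext ⟨v, hv⟩ y
      change P.toNormalForm (P.ofNormalForm v) y = v y
      by_cases hy : y ∈ Set.Icc 0 P.B
      · have hx := hP.liouvilleInv_mem hy
        rw [toNormalForm_of_mem _ hy, ofNormalForm_of_mem _ hx, hP.invOn_liouvilleInv.2 hy,
          mul_div_cancel₀ _ (Complex.ofReal_ne_zero.2 (hP.weight_pos hx).ne')]
      · exact (toNormalForm_of_notMem _ hy).trans (hv.zero_outside y hy).symm)
    (by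
      ext ⟨u, hu⟩ x
      change P.ofNormalForm (P.toNormalForm u) x = u x
      by_cases hx : x ∈ P.dom
      · rw [ofNormalForm_of_mem _ hx, toNormalForm_of_mem _ (hP.bijOn_liouvilleVar.mapsTo hx),
          hP.invOn_liouvilleInv.1 hx,
          mul_div_cancel_left₀ _ (Complex.ofReal_ne_zero.2 (hP.weight_pos hx).ne')]
      · exact (ofNormalForm_of_notMem _ hx).trans (hu.zero_outside x hx).symm)

theorem eig_normalForm (hP : P.IsRegular) (k : ℕ) : P.normalForm.eig k = P.eig k := by
  have : P.normalForm.count = P.count := by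
    funext t
    simp only [count, (hP.eigenspaceEquiv _).finrank_eq]
  rw [eig, eig, this]

end IsRegular

/-- Self-adjoint boundary conditions are isotropic. -/
theorem isotropicBC_of_selfAdjoint {M N : Matrix (Fin 2) (Fin 2) ℂ}
    (hrank : (Matrix.fromCols M N).rank = 2)
    (h : M * !![0, -1; 1, 0] * M.conjTranspose = N * !![0, -1; 1, 0] * N.conjTranspose) :
    IsotropicBC M N := by
  set E : Matrix (Fin 2) (Fin 2) ℂ := !![0, -1; 1, 0] with hE
  have hEE : E * E = -1 := by
    ext i j
    fin_cases i <;> fin_cases j <;> simp [hE]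
  -- Let `W = (M | N)` and `J = diag(E, -E)`. Self-adjointness reads `W J W* = 0`, so the range of
  -- `J W*` lies in the kernel of `W`. Both have dimension two, hence they coincide, and this
  -- parametrizes all admissible boundary values.
  have hsurj : ∀ a b : Fin 2 → ℂ, M.mulVec a + N.mulVec b = 0 →
      ∃ c : Fin 2 → ℂ, a = (E * M.conjTranspose).mulVec c ∧
        b = -(E * N.conjTranspose).mulVec c := by
    set W := Matrix.fromCols M N with hW
    set J : Matrix (Fin 2 ⊕ Fin 2) (Fin 2 ⊕ Fin 2) ℂ := Matrix.fromBlocks E 0 0 (-E) with hJ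
    have hJJ : (-J) * J = 1 := by
      rw [hJ, Matrix.neg_mul, Matrix.fromBlocks_multiply]
      simp [hEE, Matrix.fromBlocks_neg, Matrix.fromBlocks_one]
    have hJu : IsUnit J.det := (Matrix.isUnit_iff_isUnit_det J).1
      (IsUnit.of_mul_eq_one_right _ hJJ)
    have hZ : W * (J * W.conjTranspose) = 0 := by
      rw [hW, hJ, Matrix.conjTranspose_fromCols_eq_fromRows_conjTranspose,
        Matrix.fromBlocks_mul_fromRows, Matrix.fromCols_mul_fromRows]
      simp [← Matrix.mul_assoc, h]
    have hle : LinearMap.range (J * W.conjTranspose).mulVecLin ≤ LinearMap.ker W.mulVecLin := by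
      rintro _ ⟨c, rfl⟩
      simp [hZ]
    have hr : Module.finrank ℂ (LinearMap.range (J * W.conjTranspose).mulVecLin) = 2 := by
      change (J * W.conjTranspose).rank = 2
      open scoped ComplexOrder in
      rw [Matrix.rank_mul_eq_right_of_isUnit_det _ _ hJu, Matrix.rank_conjTranspose, hrank]
    have hk : Module.finrank ℂ (LinearMap.ker W.mulVecLin) = 2 := by
      have h1 := LinearMap.finrank_range_add_finrank_ker W.mulVecLin
      have h2 : Module.finrank ℂ (LinearMap.range W.mulVecLin) = 2 := hrank
      rw [h2] at h1
      simp at h1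
      omega
    have heq := Submodule.eq_of_le_of_finrank_eq hle (hr.trans hk.symm)
    intro a b hab
    have hm : Sum.elim a b ∈ LinearMap.ker W.mulVecLin := by
      simpa [hW, Matrix.fromCols_mulVec] using hab
    rw [← heq] at hm
    obtain ⟨c, hc⟩ := hm
    rw [Matrix.mulVecLin_apply, hW, hJ, Matrix.conjTranspose_fromCols_eq_fromRows_conjTranspose,
      Matrix.fromBlocks_mul_fromRows, Matrix.fromRows_mulVec, Matrix.zero_mul, Matrix.zero_mul,
      add_zero, zero_add, Matrix.neg_mul, Matrix.neg_mulVec] at hc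
    exact ⟨c, funext fun i => (congrFun hc (Sum.inl i)).symm,
      funext fun i => (congrFun hc (Sum.inr i)).symm⟩
  have hform : ∀ a a' : Fin 2 → ℂ,
      star (a 0) * a' 1 - star (a 1) * a' 0 = star a ⬝ᵥ (-E).mulVec a' := by
    intro a a'
    simp [hE, Matrix.mulVec, dotProduct, Fin.sum_univ_two]
    ring
  intro a b a' b' hab hab'
  obtain ⟨c, rfl, rfl⟩ := hsurj a' b' hab'
  rw [hform, hform, Matrix.mulVec_neg, Matrix.mulVec_mulVec, Matrix.mulVec_mulVec]
  have e : ∀ A : Matrix (Fin 2) (Fin 2) ℂ, -E * (E * A.conjTranspose) = A.conjTranspose := by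
    intro A
    rw [← Matrix.mul_assoc, Matrix.neg_mul, hEE, neg_neg, Matrix.one_mul]
  -- After inserting the parametrization the two sides become `(M a)* c` and `-(N b)* c`, which
  -- agree because `M a = -N b`.
  rw [e, e, dotProduct_neg, Matrix.dotProduct_mulVec, Matrix.dotProduct_mulVec,
    ← Matrix.star_mulVec, ← Matrix.star_mulVec, ← neg_dotProduct, ← star_neg,
    eq_neg_of_add_eq_zero_left hab]

namespace IsRegular

/-- The transition matrices are real with determinant `1`, so they preserve the boundary form, and
isotropy passes to the transformed conditions. -/
theorem isotropicBC_normalForm (hP : P.IsRegular) :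
    IsotropicBC (P.bcL * P.transition P.a) (P.bcR * P.transition P.b) := by
  intro a b a' b' hab hab'
  have key : ∀ x ∈ P.dom, ∀ a a' : Fin 2 → ℂ,
      star ((P.transition x).mulVec a 0) * (P.transition x).mulVec a' 1 -
        star ((P.transition x).mulVec a 1) * (P.transition x).mulVec a' 0 =
      star (a 0) * a' 1 - star (a 1) * a' 0 := by
    intro x hx a a'
    have hm : (P.weight x : ℂ) ≠ 0 := Complex.ofReal_ne_zero.2 (hP.weight_pos hx).ne'
    have e : ∀ c : Fin 2 → ℂ, c = ![c 0, c 1] := fun c => by ext i; fin_cases i <;> rfl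
    rw [e a, e a', hP.mulVec_transition hx, hP.mulVec_transition hx]
    simp
    field_simp
    ring
  rw [← Matrix.mulVec_mulVec, ← Matrix.mulVec_mulVec] at hab hab'
  rw [← key _ hP.left_mem a a', ← key _ hP.right_mem b b']
  exact isotropicBC_of_selfAdjoint hP.bc_rank hP.bc_selfAdjoint _ _ _ _ hab hab'

theorem tendsto_div_eig_normalForm (hP : P.IsRegular) :
    Tendsto (fun k : ℕ => ((k : ℝ) ^ 2 * Real.pi ^ 2 / P.B ^ 2) / P.normalForm.eig k) atTop
      (𝓝 1) :=
  tendsto_div_eig_schrodingerProblem hP.B_pos hP.continuousOn_potential hP.isotropicBC_normalForm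

end IsRegular
end SturmLiouville

/-! ### Limits of scaled samples and of relative errors -/

theorem tendsto_sq_mul_of_isEquivalent_sq {f : ℝ → ℝ} {A : ℝ}
    (hf : f ~[𝓝[>] 0] fun x => x ^ 2 * A) {d : ℕ → ℕ} (hd : Tendsto d atTop atTop) {k : ℕ}
    (hk : 1 ≤ k) :
    Tendsto (fun n => ((d n : ℝ) + 1) ^ 2 * f ((k : ℝ) / ((d n : ℝ) + 1))) atTop
      (𝓝 ((k : ℝ) ^ 2 * A)) := by
  have hk0 : (0 : ℝ) < k := by exact_mod_cast hk
  have hd' : Tendsto (fun n => (d n : ℝ) + 1) atTop atTop :=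
    tendsto_atTop_add_const_right _ _ (tendsto_natCast_atTop_atTop.comp hd)
  have hx : Tendsto (fun n => (k : ℝ) / ((d n : ℝ) + 1)) atTop (𝓝[>] 0) :=
    tendsto_nhdsWithin_iff.2 ⟨hd'.const_div_atTop _,
      Eventually.of_forall fun n => by simp only [Set.mem_Ioi]; positivity⟩
  have h := (IsEquivalent.refl (u := fun n => ((d n : ℝ) + 1) ^ 2) (l := atTop)).mul
    (hf.comp_tendsto hx)
  refine h.symm.tendsto_nhds (tendsto_const_nhds.congr fun n => ?_)
  have : (d n : ℝ) + 1 ≠ 0 := by positivity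
  simp only [Function.comp_apply, Pi.mul_apply]
  field_simp

theorem tendsto_samplingError {d : ℕ → ℕ} {s lam : ℕ → ℝ} {A μ : ℝ} (hμ : μ ≠ 0)
    (hs : Tendsto (fun n => ((d n : ℝ) + 1) ^ 2 * s n) atTop (𝓝 A))
    (hlam : Tendsto lam atTop (𝓝 μ)) :
    Tendsto (fun n => samplingError (d n) (s n) (lam n)) atTop (𝓝 |A / μ - 1|) :=
  ((hs.div hlam hμ).sub_const 1).abs

end

theorem propositionA1 (P : SturmLiouville) (hP : P.IsRegular) :
    ∃ c : ℕ → ℝ,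
      (∀ k, 0 ≤ c k) ∧
      Tendsto c atTop (𝓝 0) ∧
      -- `c` is determined by the Liouville normal form
      (∀ k, 1 ≤ k → P.eig k ≠ 0 →
        c k = |((k : ℝ) ^ 2 * Real.pi ^ 2 / P.B ^ 2) / P.normalForm.eig k - 1|) ∧
      -- `L η n` is the discrete operator of order of approximation `η` and mesh parameter `n`
      ∀ (d : ℕ → ℕ → ℕ) (L : (η n : ℕ) → Matrix (Fin (d η n)) (Fin (d η n)) ℂ)
        (ω : ℕ → ℝ × ℝ → ℝ),
        (∀ η, Tendsto (d η) atTop atTop) →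
        (∀ η n, HasRealEigenvalues (L η n)) →
        (∀ η k, 1 ≤ k → Tendsto (fun n => matrixEig (L η n) k) atTop (𝓝 (P.eig k))) →
        (∀ η, IntegrableOn (ω η) (symbolDomain P)) →
        (∀ η, HasSpectralSymbol (d η)
          (fun n => ((((d η n : ℂ) + 1) ^ 2)⁻¹ : ℂ) • L η n) (symbolDomain P) (ω η)) →
        (∀ η, rearrangement (symbolDomain P) (ω η) ~[𝓝[>] 0]
          fun x => x ^ 2 * Real.pi ^ 2 / P.B ^ 2) →
        ∀ η k, 1 ≤ k → P.eig k ≠ 0 →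
          Tendsto (fun n => samplingError (d η n)
              (rearrangement (symbolDomain P) (ω η) ((k : ℝ) / ((d η n : ℝ) + 1)))
              (matrixEig (L η n) k)) atTop (𝓝 (c k)) ∧
          Tendsto (fun n => samplingError (d η n)
              (rearrangement (symbolDomain P) (ω η) ((k : ℝ) / ((d η n : ℝ) + 1)))
              (P.normalForm.eig k)) atTop (𝓝 (c k)) ∧
          -- the analytic spectral error: the eigenvalue is taken on a finer mesh `n'`, and the
          -- sample of the rearrangement may be replaced by a sufficiently good approximation `s`
          ∀ (n' : ℕ → ℕ) (s : ℕ → ℝ), Tendsto n' atTop atTop →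
            Tendsto (fun n => ((d η n : ℝ) + 1) ^ 2 * (s n -
              rearrangement (symbolDomain P) (ω η) ((k : ℝ) / ((d η n : ℝ) + 1))))
              atTop (𝓝 0) →
            Tendsto (fun n => samplingError (d η n) (s n) (matrixEig (L η (n' n)) k)) atTop
              (𝓝 (c k)) := by
  have hpi := Real.pi_pos
  -- The formula is used for every `k`. Where the eigenvalue vanishes, division by zero makes the
  -- value `1`; by Weyl's law this occurs for finitely many `k` only.
  refine ⟨fun k => |((k : ℝ) ^ 2 * Real.pi ^ 2 / P.B ^ 2) / P.normalForm.eig k - 1|,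
    fun k => abs_nonneg _, ?_, fun k _ _ => rfl, ?_⟩
  · simpa using (hP.tendsto_div_eig_normalForm.sub_const 1).abs
  · intro d L ω hd _ hL _ _ hω η k hk hk0
    have hLk := hL η k hk
    rw [← hP.eig_normalForm] at hk0 hLk
    have hs : Tendsto (fun n => ((d η n : ℝ) + 1) ^ 2 *
        rearrangement (symbolDomain P) (ω η) ((k : ℝ) / ((d η n : ℝ) + 1))) atTop
        (𝓝 ((k : ℝ) ^ 2 * Real.pi ^ 2 / P.B ^ 2)) := by
      rw [mul_div_assoc]
      refine tendsto_sq_mul_of_isEquivalent_sq ?_ (hd η) hk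
      simpa only [mul_div_assoc] using hω η
    refine ⟨tendsto_samplingError hk0 hs hLk, tendsto_samplingError hk0 hs
      tendsto_const_nhds, fun n' s hn' hs' => tendsto_samplingError hk0 ?_
      (hLk.comp hn')⟩
    -- The approximate samples have the same scaled limit as the exact ones, since the scaled
    -- difference tends to `0`.
    refine (by simpa using hs'.add hs : Tendsto _ _ _).congr fun n => ?_
    ring
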